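/- Let $\mathcal A$ be a finite alphabet and let $\vartheta$ be a random substitution on $\mathcal A$: to every letter $a$ it assigns a finite non-empty set $\vartheta(a)=\{w^{(a,1)},\dots,w^{(a,k_a)}\}$ of non-empty words, together with a probability vector $\boldsymbol p_a=(p_{a1},\dots,p_{ak_a})$. The family $\boldsymbol P=(\boldsymbol p_a)_{a\in\mathcal A}$ is called non-degenerate if all $p_{aj}>0$. A realisation of $\vartheta(u)$, for a word $u$, is obtained by replacing each letter of $u$ independently by one of its images and concatenating; $\vartheta^k$ is the $k$-fold iteration. Assume that $\vartheta$ is primitive: there is $k\ge 1$ such that for all letters $a,b$ the letter $a$ occurs in some realisation of $\vartheta^k(b)$. A word is legal if it is a subword of some realisation of $\vartheta^k(a)$ for some $k\ge1$ and some letter $a$. Let $X_\vartheta\subseteq\mathcal A^{\mathbb Z}$ be the subshift of all bi-infinite sequences all of whose finite subwords are legal, let $S$ be the shift, and assume $X_\vartheta\neq\varnothing$. For $\ell\ge 1$ let $\mathcal A_\ell$ be the set of legal words of length $\ell$. For non-degenerate $\boldsymbol P$ let $\vartheta_\ell$ be the induced random substitution on the alphabet $\mathcal A_\ell$: it sends $u=u_0\cdots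 u_{\ell-1}\in\mathcal A_\ell$ to the word $(v_{[k,k+\ell-1]})_{0\le k\le m-1}$ over $\mathcal A_\ell$, where $v$ is the random realisation of $\vartheta(u)$ obtained by choosing the images of the letters of $u$ independently according to $\boldsymbol P$, and $m$ is the length of the chosen image of $u_0$. Let $M_\ell=M_\ell(\boldsymbol P)$ be its substitution matrix, whose $(u',u)$ entry is the expected number of occurrences of $u'$ in $\vartheta_\ell(u)$, and let $\boldsymbol R_\ell=\boldsymbol R_\ell(\boldsymbol P)$ be the right Perron--Frobenius eigenvector of the primitive matrix $M_\ell$, normalised by $\|\boldsymbol R_\ell\|_1=1$. Let $\mu=\mu_{\boldsymbol P}$ be the unique Borel probability measure on $X_\vartheta$ with $$\mu\bigl(\{x\in X_\vartheta : x_{[k,k+\ell-1]}=v\}\bigr)=\boldsymbol R_\ell(v)\qquad(\ell\ge1,\ v\in\mathcal A_\ell,\ k\in\mathbb Z).$$ **Proposition.** Let $\vartheta$ be primitive with $X_\vartheta\ne\varnothing$, let $\boldsymbol P$ be non-degenerate, and suppose that $\mu_{\boldsymbol P}$ is ergodic for $S$. Then $(X_\vartheta,S)$ is minimal (every orbit $\{S^kx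 : k\in\mathbb Z\}$ is dense in $X_\vartheta$) if and only if the vectors $\boldsymbol R_\ell$ do not depend on the probability vectors, that is, $\boldsymbol R_\ell(\boldsymbol Q)=\boldsymbol R_\ell(\boldsymbol Q')$ for all $\ell\ge 1$ and all non-degenerate families $\boldsymbol Q,\boldsymbol Q'$ of probability vectors for $\vartheta$. -/

import Mathlib

open SymbolicDynamics.FullShift MeasureTheory

/-- A finite-set-valued substitution rule: every letter is sent to a non-empty finite set of
non-empty words. -/
structure RandomSubstitution (A : Type*) where
  /-- The set of possible images of a letter. -/
  words : A → Finset (List A)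
  words_nonempty : ∀ a, (words a).Nonempty
  ne_nil : ∀ a, ∀ w ∈ words a, w ≠ []

namespace RandomSubstitution

/-- A family of probability vectors for `θ`, one for each letter `a`, indexed by the possible
images of `a`. -/
structure Probabilities {A : Type*} (θ : RandomSubstitution A) where
  prob : (a : A) → θ.words a → ℝ
  nonneg : ∀ a w, 0 ≤ prob a w
  sum_eq_one : ∀ a, ∑ w, prob a w = 1

/-- No possible image has probability zero. -/
def Probabilities.NonDegenerate {A : Type*} {θ : RandomSubstitution A}
    (P : θ.Probabilities) : Prop :=
  ∀ a w, P.prob a w ≠ 0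

/-- `θ.IsRealisation u v`: the word `v` is a possible value of `θ(u)`, i.e. it is obtained from `u`
by replacing every letter independently by one of its images and concatenating. -/
inductive IsRealisation {A : Type*} (θ : RandomSubstitution A) : List A → List A → Prop
  | nil : IsRealisation θ [] []
  | cons {a : A} {w u v : List A} (hw : w ∈ θ.words a) (h : IsRealisation θ u v) :
      IsRealisation θ (a :: u) (w ++ v)

/-- `θ.IsPowRealisation k u v`: the word `v` is a possible value of `θ^k(u)`. -/
def IsPowRealisation {A : Type*} (θ : RandomSubstitution A) : ℕ → List A → List A → Prop
  | 0, u, v => v = u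
  | k + 1, u, v => ∃ v', θ.IsPowRealisation k u v' ∧ θ.IsRealisation v' v

/-- `u` is a subword of some realisation of `θ^k(v)`. -/
def IsSubwordPow {A : Type*} (θ : RandomSubstitution A) (k : ℕ) (u v : List A) : Prop :=
  ∃ v', θ.IsPowRealisation k v v' ∧ u <:+: v'

/-- There is one power `k` such that every letter occurs in some realisation of `θ^k` of every
letter. -/
def IsPrimitive {A : Type*} (θ : RandomSubstitution A) : Prop :=
  ∃ k : ℕ, 1 ≤ k ∧ ∀ a b : A, θ.IsSubwordPow k [a] [b]

/-- The `θ`-legal words. -/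
def IsLegal {A : Type*} (θ : RandomSubstitution A) (u : List A) : Prop :=
  ∃ k : ℕ, 1 ≤ k ∧ ∃ a : A, θ.IsSubwordPow k u [a]

/-! ### The subshift -/

/-- The word `x_k x_{k+1} ⋯ x_{k+ℓ-1}`. -/
def subwordAt {A : Type*} (x : ℤ → A) (k : ℤ) (ℓ : ℕ) : List A :=
  List.ofFn fun i : Fin ℓ => x (k + i)

/-- The subshift `X_θ` of all bi-infinite sequences all of whose finite subwords are legal. -/
def subshift {A : Type*} [TopologicalSpace A] [DiscreteTopology A] (θ : RandomSubstitution A) :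
    Subshift A ℤ where
  carrier := {x | ∀ (k : ℤ) (ℓ : ℕ), θ.IsLegal (subwordAt x k ℓ)}
  isClosed := by
    simp only [Set.ofPred_forall]
    refine isClosed_iInter fun k => isClosed_iInter fun ℓ => ?_
    have hc : Continuous fun (x : ℤ → A) (i : Fin ℓ) => x (k + i) := by fun_prop
    exact (isClosed_discrete {f : Fin ℓ → A | θ.IsLegal (List.ofFn f)}).preimage hc
  mapsTo := by
    intro g x hx k ℓ
    have h := hx (g + k) ℓ
    simpa [subwordAt, shift, add_assoc] using h

/-- The points of `X_θ`, with the topology and the σ-algebra induced from `A^ℤ`. -/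
abbrev Space {A : Type*} [TopologicalSpace A] [DiscreteTopology A] (θ : RandomSubstitution A) :
    Type _ :=
  ↥θ.subshift.carrier

/-- The action of `ℤ` on `X_θ` by powers of the shift: `(k +ᵥ x) i = x (k + i)`. -/
instance {A : Type*} [TopologicalSpace A] [DiscreteTopology A] (θ : RandomSubstitution A) :
    AddAction ℤ θ.Space where
  vadd k x := ⟨shift k x.1, θ.subshift.mapsTo k x.2⟩
  zero_vadd x := Subtype.ext (shift_zero x.1)
  add_vadd k l x := Subtype.ext (by rw [add_comm k l]; exact shift_add l k x.1)

/-- The shift map `S` on `X_θ`, `S(x)_i = x_{i+1}`. -/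
def shiftMap {A : Type*} [TopologicalSpace A] [DiscreteTopology A] (θ : RandomSubstitution A)
    (x : θ.Space) : θ.Space :=
  (1 : ℤ) +ᵥ x

/-! ### Substitution matrices -/

/-- The substitution matrix: the `(i, j)` entry is the expected number of occurrences of the letter
`i` in `θ(j)`. -/
def Probabilities.matrix {A : Type*} [DecidableEq A] {θ : RandomSubstitution A}
    (P : θ.Probabilities) : Matrix A A ℝ :=
  Matrix.of fun i j => ∑ w : θ.words j, P.prob j w * (w.1.count i : ℝ)

/-- The alphabet `A_ℓ` of legal words of length `ℓ`. -/
abbrev LegalWord {A : Type*} (θ : RandomSubstitution A) (ℓ : ℕ) : Type _ :=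
  {u : Fin ℓ → A // θ.IsLegal (List.ofFn u)}

noncomputable instance {A : Type*} [Fintype A] (θ : RandomSubstitution A) (ℓ : ℕ) :
    Fintype (θ.LegalWord ℓ) :=
  Fintype.ofInjective (fun u : θ.LegalWord ℓ => u.1) Subtype.val_injective

/-- A simultaneous choice of an image for every letter of the word `u`. -/
abbrev Choice {A : Type*} (θ : RandomSubstitution A) {ℓ : ℕ} (u : Fin ℓ → A) : Type _ :=
  (i : Fin ℓ) → θ.words (u i)

/-- The realisation of `θ(u)` given by a choice: the concatenation of the chosen images. -/
def Choice.word {A : Type*} {θ : RandomSubstitution A} {ℓ : ℕ} {u : Fin ℓ → A}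
    (c : θ.Choice u) : List A :=
  (List.ofFn fun i => (c i).1).flatten

theorem IsRealisation.append {A : Type*} {θ : RandomSubstitution A} {u v u' v' : List A}
    (h : θ.IsRealisation u v) (h' : θ.IsRealisation u' v') :
    θ.IsRealisation (u ++ u') (v ++ v') := by
  induction h with
  | nil => simpa using h'
  | cons hw _ ih => simpa using IsRealisation.cons hw ih

theorem exists_isRealisation {A : Type*} (θ : RandomSubstitution A) (u : List A) :
    ∃ v, θ.IsRealisation u v := by
  induction u with
  | nil => exact ⟨_, .nil⟩
  | cons a u ih =>
    obtain ⟨v, hv⟩ := ih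
    obtain ⟨w, hw⟩ := θ.words_nonempty a
    exact ⟨_, .cons hw hv⟩

theorem Choice.isRealisation {A : Type*} {θ : RandomSubstitution A} {ℓ : ℕ} {u : Fin ℓ → A}
    (c : θ.Choice u) : θ.IsRealisation (List.ofFn u) c.word := by
  induction ℓ with
  | zero => simpa [Choice.word] using IsRealisation.nil
  | succ ℓ ih =>
    have h := ih (u := fun i => u i.succ) fun i => c i.succ
    simpa [Choice.word, List.ofFn_succ] using IsRealisation.cons (c 0).2 h

/-- Subwords of realisations of legal words are legal. -/
theorem IsLegal.of_isRealisation {A : Type*} {θ : RandomSubstitution A} {u v w : List A}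
    (hu : θ.IsLegal u) (hv : θ.IsRealisation u v) (hw : w <:+: v) : θ.IsLegal w := by
  obtain ⟨k, hk, a, x, hx, s, t, rfl⟩ := hu
  obtain ⟨s', hs⟩ := θ.exists_isRealisation s
  obtain ⟨t', ht⟩ := θ.exists_isRealisation t
  exact ⟨k + 1, by omega, a, s' ++ v ++ t', ⟨_, hx, (hs.append hv).append ht⟩,
    hw.trans ⟨s', t', rfl⟩⟩

/-- Every letter after the first contributes at least one letter to the image. -/
theorem Choice.length_le {A : Type*} {θ : RandomSubstitution A} {ℓ : ℕ} [NeZero ℓ]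
    {u : Fin ℓ → A} (c : θ.Choice u) : (c 0).1.length + ℓ ≤ c.word.length + 1 := by
  obtain _ | ℓ := ℓ
  · exact absurd rfl (NeZero.ne 0)
  have h1 : ∀ i : Fin ℓ, 1 ≤ (c i.succ).1.length := fun i =>
    List.length_pos_of_ne_nil (θ.ne_nil _ _ (c i.succ).2)
  have h2 : ∑ _i : Fin ℓ, 1 ≤ ∑ i : Fin ℓ, (c i.succ).1.length :=
    Finset.sum_le_sum fun i _ => h1 i
  have h3 : c.word.length = (c 0).1.length + ∑ i : Fin ℓ, (c i.succ).1.length := by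
    simp [Choice.word, List.ofFn_succ, List.length_flatten, List.sum_ofFn, Function.comp_def]
  simp only [Finset.sum_const, Finset.card_univ, Fintype.card_fin, smul_eq_mul, mul_one] at h2
  omega

/-- For `u` a legal word of length `ℓ` and a choice `c` of images with concatenation `v`, the word
over the alphabet `A_ℓ` which lists the subwords `v_{[k, k+ℓ-1]}` for `0 ≤ k < |c 0|`, where `c 0`
is the chosen image of the first letter of `u`. -/
def Choice.blocks {A : Type*} {θ : RandomSubstitution A} {ℓ : ℕ} [NeZero ℓ]
    (u : θ.LegalWord ℓ) (c : θ.Choice u.1) : List (θ.LegalWord ℓ) :=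
  List.ofFn fun k : Fin (c 0).1.length =>
    have hlen : ∀ i : Fin ℓ, (k : ℕ) + i < c.word.length := fun i => by
      have := c.length_le
      have := k.2
      have := i.2
      omega
    ⟨fun i => c.word[(k : ℕ) + i]'(hlen i), by
      refine u.2.of_isRealisation c.isRealisation ?_
      have h : (List.ofFn fun i : Fin ℓ => c.word[(k : ℕ) + i]'(hlen i)) =
          (c.word.drop k).take ℓ := by
        have hl : (k : ℕ) + ℓ ≤ c.word.length := by
          have := c.length_le
          have := k.2
          omega
        apply List.ext_getElem
        · simp only [List.length_ofFn, List.length_take, List.length_drop]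
          omega
        · intro n h1 h2
          simp
      rw [h]
      exact (List.take_prefix _ _).isInfix.trans (List.drop_suffix _ _).isInfix⟩

/-- The induced random substitution `θ_ℓ` on the alphabet of legal words of length `ℓ`. -/
def induced {A : Type*} [DecidableEq A] (θ : RandomSubstitution A) (ℓ : ℕ) [NeZero ℓ] :
    RandomSubstitution (θ.LegalWord ℓ) where
  words u := Finset.univ.image (Choice.blocks u)
  words_nonempty u :=
    have : Nonempty (θ.Choice u.1) :=
      ⟨fun i => ⟨_, (θ.words_nonempty (u.1 i)).choose_spec⟩⟩
    Finset.univ_nonempty.image _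
  ne_nil u w hw := by
    obtain ⟨c, -, rfl⟩ := Finset.mem_image.1 hw
    have := List.length_pos_of_ne_nil (θ.ne_nil _ _ (c 0).2)
    intro h
    have h' := congrArg List.length h
    rw [Choice.blocks, List.length_ofFn, List.length_nil] at h'
    omega

/-- The probabilities of the induced random substitution: the images of the letters of `u` are
chosen independently. -/
def Probabilities.induced {A : Type*} [DecidableEq A] {θ : RandomSubstitution A}
    (P : θ.Probabilities) (ℓ : ℕ) [NeZero ℓ] : (θ.induced ℓ).Probabilities where
  prob u w := ∑ c : θ.Choice u.1 with Choice.blocks u c = w.1, ∏ i, P.prob (u.1 i) (c i)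
  nonneg u w := Finset.sum_nonneg fun c _ => Finset.prod_nonneg fun i _ => P.nonneg _ _
  sum_eq_one u := by
    have h : ∑ c : θ.Choice u.1, ∏ i, P.prob (u.1 i) (c i) = 1 := by
      rw [← Fintype.prod_sum fun i => P.prob (u.1 i)]
      exact Finset.prod_eq_one fun i _ => P.sum_eq_one _
    rw [← h, ← Finset.sum_fiberwise_of_maps_to (s := Finset.univ)
      (t := (θ.induced ℓ).words u) (g := Choice.blocks u)
      (fun c _ => Finset.mem_image_of_mem _ (Finset.mem_univ c))]
    exact Finset.sum_coe_sort ((θ.induced ℓ).words u) fun w =>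
      ∑ c : θ.Choice u.1 with Choice.blocks u c = w, ∏ i, P.prob (u.1 i) (c i)

/-! ### Perron–Frobenius vectors and the measure -/

/-- `R` is a strictly positive right eigenvector of `M` of `ℓ¹`-norm one, for a positive eigenvalue
which is maximal in modulus among all complex eigenvalues of `M`. For a primitive matrix there is
exactly one such vector. -/
def _root_.Matrix.IsPerronFrobeniusVector {B : Type*} [Fintype B] [DecidableEq B]
    (M : Matrix B B ℝ) (R : B → ℝ) : Prop :=
  (∀ b, 0 < R b) ∧ ∑ b, R b = 1 ∧
    ∃ lam : ℝ, 0 < lam ∧ (∀ z ∈ spectrum ℂ (M.map ((↑) : ℝ → ℂ)), ‖z‖ ≤ lam) ∧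
      M.mulVec R = lam • R

open Classical in
/-- The normalised right Perron–Frobenius eigenvector `R_ℓ` of the matrix `M_ℓ` of the induced
random substitution `θ_ℓ` (set to `0` if there is none, which does not happen when `θ` is
primitive, `X_θ` is non-empty and the probabilities are non-degenerate). -/
noncomputable def Probabilities.rightVector {A : Type*} [Fintype A] [DecidableEq A]
    {θ : RandomSubstitution A} (P : θ.Probabilities) (ℓ : ℕ) [NeZero ℓ] : θ.LegalWord ℓ → ℝ :=
  if h : ∃ R, (P.induced ℓ).matrix.IsPerronFrobeniusVector R then h.choose else 0

/-- The cylinder set of all `x ∈ X_θ` with `x_{[k, k+ℓ-1]} = v`. -/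
def cylinderAt {A : Type*} [TopologicalSpace A] [DiscreteTopology A] (θ : RandomSubstitution A)
    {ℓ : ℕ} (k : ℤ) (v : Fin ℓ → A) : Set θ.Space :=
  {x | ∀ i : Fin ℓ, x.1 (k + i) = v i}

/-- `μ` is a probability measure on `X_θ` which gives the mass `R_ℓ(v)` to each cylinder set of
each legal word `v` of length `ℓ ≥ 1`. There is at most one such measure, since the cylinder sets
generate the σ-algebra. -/
def Probabilities.IsFrequencyMeasure {A : Type*} [Fintype A] [DecidableEq A] [TopologicalSpace A]
    [DiscreteTopology A] [MeasurableSpace A] {θ : RandomSubstitution A} (P : θ.Probabilities)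
    (μ : Measure θ.Space) : Prop :=
  IsProbabilityMeasure μ ∧ ∀ (ℓ : ℕ) [NeZero ℓ] (v : θ.LegalWord ℓ) (k : ℤ),
    μ (θ.cylinderAt k v.1) = ENNReal.ofReal (P.rightVector ℓ v)

open Classical in
/-- The measure `μ` on `X_θ` determined by the vectors `R_ℓ` (set to `0` if there is none, which
does not happen when `θ` is primitive, `X_θ` is non-empty and the probabilities are
non-degenerate). -/
noncomputable def Probabilities.frequencyMeasure {A : Type*} [Fintype A] [DecidableEq A]
    [TopologicalSpace A] [DiscreteTopology A] [MeasurableSpace A] {θ : RandomSubstitution A}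
    (P : θ.Probabilities) : Measure θ.Space :=
  if h : ∃ μ, P.IsFrequencyMeasure μ then h.choose else 0

end RandomSubstitution

/-! ### Deterministic substitutions on words -/

namespace WordSubstitution

variable {A : Type*}

/-- The image of the letter `a` under the `n`-th iterate of the substitution `τ`. -/
def iter (τ : A → List A) : ℕ → A → List A
  | 0, a => [a]
  | n + 1, a => (iter τ n a).flatMap τ

theorem flatMap_iter_zero (τ : A → List A) (u : List A) : u.flatMap (iter τ 0) = u := by
  simp [iter]

theorem iter_add (τ : A → List A) (m n : ℕ) (a : A) :
    iter τ (m + n) a = (iter τ m a).flatMap (iter τ n) := by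
  induction n with
  | zero => rw [flatMap_iter_zero, add_zero]
  | succ n ih => rw [← add_assoc, iter, ih, List.flatMap_assoc]; rfl

theorem iter_succ' (τ : A → List A) (n : ℕ) (a : A) :
    iter τ (n + 1) a = (τ a).flatMap (iter τ n) := by
  rw [add_comm, iter_add]
  simp [iter]

theorem infix_flatMap {τ : A → List A} {u v : List A} (h : u <:+: v) :
    u.flatMap τ <:+: v.flatMap τ := by
  obtain ⟨s, t, rfl⟩ := h
  exact ⟨s.flatMap τ, t.flatMap τ, by simp⟩

theorem infix_flatMap_of_mem {τ : A → List A} {a : A} {u : List A} (h : a ∈ u) :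
    τ a <:+: u.flatMap τ := by
  obtain ⟨s, t, rfl⟩ := List.append_of_mem h
  exact ⟨s.flatMap τ, t.flatMap τ, by simp⟩

theorem length_flatMap_le {τ : A → List A} {L : ℕ} {u : List A}
    (hL : ∀ c ∈ u, (τ c).length ≤ L) : (u.flatMap τ).length ≤ u.length * L := by
  induction u with
  | nil => simp
  | cons a u ih =>
    have h1 := hL a (by simp)
    have h2 := ih fun c hc => hL c (by simp [hc])
    simp only [List.flatMap_cons, List.length_append, List.length_cons]
    linarith

/-- A long subword of `τ(z)` contains the full image of a subword of `z`. -/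
theorem exists_flatMap_infix_of_infix_flatMap {τ : A → List A} {z v : List A} {D L : ℕ}
    (hL : ∀ c, (τ c).length ≤ L) (hL0 : 0 < L) (h : v <:+: z.flatMap τ)
    (hv : (D + 1) * L ≤ v.length) :
    ∃ z', z' <:+: z ∧ z'.length = D ∧ z'.flatMap τ <:+: v := by
  obtain ⟨s, t, h⟩ := h
  rw [List.append_assoc] at h
  induction z generalizing s with
  | nil =>
    simp only [List.flatMap_nil, List.append_eq_nil_iff] at h
    have : 0 < (D + 1) * L := by positivity
    simp [h.2.1] at hv
    omega
  | cons c z ih =>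
    rw [List.flatMap_cons, List.append_eq_append_iff] at h
    obtain ⟨s', h1, h2⟩ | ⟨s', h1, h2⟩ := h
    · rw [List.append_eq_append_iff] at h2
      have hs' : s'.length ≤ L := by
        have := hL c
        rw [h1, List.length_append] at this
        omega
      obtain ⟨v', h3, h4⟩ | ⟨v', h3, h4⟩ := h2
      · have : v.length ≤ L := by rw [h3, List.length_append] at hs'; omega
        have hD : D = 0 := by
          by_contra hD
          have : 1 ≤ D := by omega
          nlinarith
        exact ⟨[], ⟨[], c :: z, by simp⟩, by simp [hD], List.nil_infix⟩
      · have hv' : D * L ≤ v'.length := by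
          rw [h3, List.length_append] at hv
          linarith
        have hzD : D ≤ z.length := by
          by_contra hc
          have h5 : (z.flatMap τ).length ≤ z.length * L := length_flatMap_le fun c _ => hL c
          rw [h4, List.length_append] at h5
          have : (z.length + 1) * L ≤ D * L := Nat.mul_le_mul_right _ (by omega)
          linarith
        refine ⟨z.take D, (List.take_prefix _ _).isInfix.trans (List.suffix_cons c z).isInfix,
          by simp [hzD], ?_⟩
        have h6 : (z.take D).flatMap τ <+: z.flatMap τ := by
          conv_rhs => rw [← List.take_append_drop D z, List.flatMap_append]
          exact List.prefix_append _ _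
        have h7 : ((z.take D).flatMap τ).length ≤ v'.length := by
          refine (length_flatMap_le fun c _ => hL c).trans ?_
          rwa [List.length_take, min_eq_left hzD]
        have h8 := List.prefix_of_prefix_length_le h6 (h4 ▸ List.prefix_append v' t) h7
        exact h8.isInfix.trans (h3 ▸ List.suffix_append s' v').isInfix
    · obtain ⟨z', hz, h3⟩ := ih s' h2.symm
      exact ⟨z', hz.trans (List.suffix_cons c z).isInfix, h3⟩

/-- A short subword of `τ(z)` is contained in the image of at most two letters. -/
theorem exists_infix_flatMap_of_length_le {τ : A → List A} {z u : List A}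
    (hu : ∀ c, u.length ≤ (τ c).length) (h : u <:+: z.flatMap τ) :
    ∃ y, y <:+: z ∧ y.length ≤ 2 ∧ u <:+: y.flatMap τ := by
  obtain ⟨s, t, h⟩ := h
  rw [List.append_assoc] at h
  induction z generalizing s with
  | nil =>
    simp only [List.flatMap_nil, List.append_eq_nil_iff] at h
    exact ⟨[], List.infix_refl _, by simp, by simp [h.2.1]⟩
  | cons c z ih =>
    rw [List.flatMap_cons, List.append_eq_append_iff] at h
    obtain ⟨s', h1, h2⟩ | ⟨s', h1, h2⟩ := h
    · cases z with
      | nil =>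
        refine ⟨[c], List.infix_refl _, by simp, s, t, ?_⟩
        simp only [List.flatMap_nil, List.append_nil] at h2
        simp [h1, h2]
      | cons d z =>
        refine ⟨[c, d], ⟨[], z, by simp⟩, by simp, ?_⟩
        have h3 : u <+: s' ++ τ d := by
          refine List.prefix_of_prefix_length_le (l₃ := u ++ t) (List.prefix_append _ _) ?_ ?_
          · rw [h2, List.flatMap_cons, ← List.append_assoc]
            exact List.prefix_append _ _
          · have := hu d
            rw [List.length_append]
            omega
        refine h3.isInfix.trans ⟨s, [], ?_⟩
        simp [h1]
    · obtain ⟨z', hz, h3⟩ := ih s' h2.symm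
      exact ⟨z', hz.trans (List.suffix_cons c z).isInfix, h3⟩

/-- `w` is a subword of some iterate of `τ` applied to a letter. -/
def Generates (τ : A → List A) (w : List A) : Prop :=
  ∃ n c, w <:+: iter τ n c

theorem Generates.of_infix {τ : A → List A} {u w : List A} (h : Generates τ w) (hu : u <:+: w) :
    Generates τ u := by
  obtain ⟨n, c, h⟩ := h
  exact ⟨n, c, hu.trans h⟩

/-- Every letter occurs in the image of every letter, and all images have at least two letters. -/
structure IsPositive (τ : A → List A) : Prop where
  mem : ∀ a b, b ∈ τ a
  two_le : ∀ a, 2 ≤ (τ a).length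

namespace IsPositive

variable {τ : A → List A}

theorem mem_iter (hτ : IsPositive τ) (n : ℕ) (a b : A) : b ∈ iter τ (n + 1) a := by
  induction n generalizing b with
  | zero => simpa [iter] using hτ.mem a b
  | succ n ih =>
    rw [iter]
    exact List.mem_flatMap.2 ⟨a, ih a, hτ.mem a b⟩

theorem lt_length_iter (hτ : IsPositive τ) (n : ℕ) (a : A) : n < (iter τ n a).length := by
  induction n generalizing a with
  | zero => simp [iter]
  | succ n ih =>
    rw [iter_succ']
    match h : τ a, hτ.two_le a with
    | b :: c :: t, _ =>
      have := ih b
      have := ih c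
      simp only [List.flatMap_cons, List.length_append]
      omega

theorem length_iter_le (hτ : IsPositive τ) {L : ℕ} (hL : ∀ a, (τ a).length ≤ L) (n : ℕ)
    (a b : A) : (iter τ n a).length ≤ L * (iter τ n b).length := by
  cases n with
  | zero =>
    have := hτ.two_le a
    have := hL a
    simp only [iter, List.length_singleton]
    omega
  | succ n =>
    rw [iter_succ' τ n a]
    refine (length_flatMap_le (L := (iter τ (n + 1) b).length) fun c _ => ?_).trans
      (Nat.mul_le_mul_right _ (hL a))
    rw [iter_succ']
    exact (infix_flatMap_of_mem (hτ.mem b c)).length_le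

theorem length_iter_succ_le (hτ : IsPositive τ) {L : ℕ} (hL : ∀ a, (τ a).length ≤ L) (n : ℕ)
    (a b : A) : (iter τ (n + 1) a).length ≤ L * (L * (iter τ n b).length) := by
  rw [iter_succ']
  exact (length_flatMap_le fun c _ => hτ.length_iter_le hL n c b).trans
    (Nat.mul_le_mul_right _ (hL a))

theorem exists_infix_flatMap_iter (hτ : IsPositive τ) {v : List A} (hv : Generates τ v) (m : ℕ) :
    ∃ z, Generates τ z ∧ v <:+: z.flatMap (iter τ m) := by
  obtain ⟨n, c, h⟩ := hv
  refine ⟨iter τ (n + 1) c, ⟨n + 1, c, List.infix_refl _⟩, ?_⟩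
  rw [← iter_add, show n + 1 + m = m + 1 + n by ring, iter_add]
  exact h.trans (infix_flatMap_of_mem (hτ.mem_iter m c c))

/-- Every generated word occurs in every long generated word. -/
theorem exists_forall_infix [Fintype A] (hτ : IsPositive τ) {w : List A} (hw : Generates τ w) :
    ∃ N, ∀ v, Generates τ v → N ≤ v.length → w <:+: v := by
  obtain ⟨n, c, h⟩ := hw
  set L := Finset.univ.sup fun a => (iter τ (n + 1) a).length
  have hL : ∀ a, (iter τ (n + 1) a).length ≤ L := fun a =>
    Finset.le_sup (f := fun a => (iter τ (n + 1) a).length) (Finset.mem_univ a)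
  have hL0 : 0 < L := (Nat.zero_lt_of_lt (hτ.lt_length_iter (n + 1) c)).trans_le (hL c)
  refine ⟨(1 + 1) * L, fun v hv hN => ?_⟩
  obtain ⟨z, -, hz⟩ := hτ.exists_infix_flatMap_iter hv (n + 1)
  obtain ⟨z', -, h1, h2⟩ := exists_flatMap_infix_of_infix_flatMap hL hL0 hz hN
  obtain ⟨d, rfl⟩ := List.length_eq_one_iff.1 h1
  refine h.trans (List.IsInfix.trans ?_ h2)
  rw [List.flatMap_singleton, iter_succ']
  exact infix_flatMap_of_mem (hτ.mem d c)

/-- The generated words are linearly recurrent. -/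
theorem exists_linear_recurrence [Fintype A] (hτ : IsPositive τ) :
    ∃ K : ℕ, ∀ u v, Generates τ u → Generates τ v → u ≠ [] → K * u.length ≤ v.length →
      u <:+: v := by
  obtain ⟨D, hD⟩ : ∃ D, ∀ y, Generates τ y → y.length ≤ 2 →
      ∀ v, Generates τ v → D ≤ v.length → y <:+: v := by
    have hN : ∀ y, ∃ N, Generates τ y → ∀ v, Generates τ v → N ≤ v.length → y <:+: v := by
      intro y
      by_cases hy : Generates τ y
      · obtain ⟨N, h⟩ := hτ.exists_forall_infix hy
        exact ⟨N, fun _ => h⟩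
      · exact ⟨0, fun h => absurd h hy⟩
    choose N hN using hN
    refine ⟨(List.finite_length_le A 2).toFinset.sup N, fun y hy h2 v hv hv' =>
      hN y hy v hv (le_trans (Finset.le_sup (f := N) ?_) hv')⟩
    simpa using h2
  set L := Finset.univ.sup fun a => (τ a).length
  have hL : ∀ a, (τ a).length ≤ L := fun a =>
    Finset.le_sup (f := fun a => (τ a).length) (Finset.mem_univ a)
  refine ⟨(D + 1) * (L * L), fun u v hu hv hu0 huv => ?_⟩
  have hex : ∃ n, ∀ c, u.length ≤ (iter τ n c).length :=
    ⟨u.length, fun c => (hτ.lt_length_iter _ c).le⟩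
  classical
  obtain ⟨n, hn, hn'⟩ : ∃ n, (∀ c, u.length ≤ (iter τ n c).length) ∧
      ∀ a, (iter τ n a).length ≤ L * (L * u.length) := by
    refine ⟨Nat.find hex, Nat.find_spec hex, fun a => ?_⟩
    have hLa : 1 ≤ L := by
      have := hτ.two_le a
      have := hL a
      omega
    have hul : 1 ≤ u.length := List.length_pos_of_ne_nil hu0
    cases hm : Nat.find hex with
    | zero =>
      have : 0 < L * (L * u.length) := by positivity
      simp only [iter, List.length_singleton]
      omega
    | succ m =>
      have := Nat.find_min hex (m := m) (by omega)
      push Not at this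
      obtain ⟨b, hb⟩ := this
      refine (hτ.length_iter_succ_le hL m a b).trans ?_
      gcongr
  obtain ⟨z, hz, hvz⟩ := hτ.exists_infix_flatMap_iter hv n
  obtain ⟨k, c, huk⟩ := hτ.exists_infix_flatMap_iter hu n
  obtain ⟨y, hy1, hy2, huy⟩ := exists_infix_flatMap_of_length_le hn huk
  have hL0 : 0 < L * (L * u.length) := by
    have : 1 ≤ u.length := List.length_pos_of_ne_nil hu0
    obtain ⟨a, -⟩ := List.exists_mem_of_ne_nil u hu0
    have := hn a
    have := hn' a
    omega
  obtain ⟨z', hz', h1, h2⟩ := exists_flatMap_infix_of_infix_flatMap hn' hL0 hvz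
    (D := D) (by linarith)
  exact huy.trans ((infix_flatMap (hD y (c.of_infix hy1) hy2 z' (hz.of_infix hz') h1.ge)).trans h2)

end IsPositive

/-! ### Frequencies of words in linearly recurrent languages -/

variable [DecidableEq A]

/-- The number of occurrences of the word `w` as a subword of a word. -/
def occ (w : List A) : List A → ℕ
  | [] => 0
  | a :: v => (if w <+: a :: v then 1 else 0) + occ w v

theorem occ_le_length (w v : List A) : occ w v ≤ v.length := by
  induction v with
  | nil => simp [occ]
  | cons a v ih =>
    simp only [occ, List.length_cons]
    split_ifs <;> omega

theorem occ_add_occ_le (w u v : List A) : occ w u + occ w v ≤ occ w (u ++ v) := by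
  induction u with
  | nil => simp [occ]
  | cons a u ih =>
    have h : w <+: a :: u → w <+: a :: (u ++ v) := fun h => h.trans (List.prefix_append (a :: u) v)
    simp only [occ, List.cons_append]
    split_ifs <;> first | omega | tauto

theorem occ_eq_sum (w v : List A) :
    occ w v = ∑ q ∈ Finset.range v.length, if w <+: v.drop q then 1 else 0 := by
  induction v with
  | nil => simp [occ]
  | cons a v ih =>
    rw [occ, ih, List.length_cons, Finset.sum_range_succ', add_comm]
    simp

/-- In a linearly recurrent factorial language every word has a uniform frequency. -/
theorem exists_frequency (Lg : List A → Prop) (hinf : ∀ u v, u <:+: v → Lg v → Lg u)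
    (hlen : ∀ N, ∃ v, Lg v ∧ v.length = N) {K : ℕ}
    (hK : ∀ u v, Lg u → Lg v → u ≠ [] → K * u.length ≤ v.length → u <:+: v) (w : List A) :
    ∃ r : ℝ, ∀ ε > 0, ∃ C : ℝ, ∀ v, Lg v →
      (r - ε) * v.length - C ≤ occ w v ∧ (occ w v : ℝ) ≤ (r + ε) * v.length + C := by
  set f : ℕ → ℕ := fun N => sInf {k | ∃ v, Lg v ∧ v.length = N ∧ occ w v = k}
  have hfle : ∀ v, Lg v → f v.length ≤ occ w v := fun v hv => Nat.sInf_le ⟨v, hv, rfl, rfl⟩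
  have hfmem : ∀ N, ∃ v, Lg v ∧ v.length = N ∧ occ w v = f N := by
    intro N
    obtain ⟨v, hv, hN⟩ := hlen N
    exact Nat.sInf_mem (s := {k | ∃ v, Lg v ∧ v.length = N ∧ occ w v = k}) ⟨_, v, hv, hN, rfl⟩
  have hsub : Subadditive fun N => -(f N : ℝ) := by
    intro m n
    obtain ⟨v, hv, hl, ho⟩ := hfmem (m + n)
    have h1 := hfle (v.take m) (hinf _ _ (List.take_prefix _ _).isInfix hv)
    have h2 := hfle (v.drop m) (hinf _ _ (List.drop_suffix _ _).isInfix hv)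
    have h3 := occ_add_occ_le w (v.take m) (v.drop m)
    rw [List.take_append_drop, ho] at h3
    rw [List.length_take, hl, min_eq_left (by omega)] at h1
    rw [List.length_drop, hl, Nat.add_sub_cancel_left] at h2
    have h4 : f m + f n ≤ f (m + n) := by omega
    have h5 : (f m + f n : ℝ) ≤ f (m + n) := by exact_mod_cast h4
    simp only
    linarith
  have hfN : ∀ N, (f N : ℝ) ≤ N := fun N => by
    obtain ⟨v, -, hl, ho⟩ := hfmem N
    have := occ_le_length w v
    rw [hl, ho] at this
    exact_mod_cast this
  have hbdd : BddBelow (Set.range fun n : ℕ => -(f n : ℝ) / n) := by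
    refine ⟨-1, ?_⟩
    rintro _ ⟨n, rfl⟩
    simp only [neg_div]
    exact neg_le_neg (div_le_one_of_le₀ (hfN n) (Nat.cast_nonneg n))
  set r : ℝ := -hsub.lim with hr
  have hfr : ∀ N, (f N : ℝ) ≤ r * N := by
    intro N
    rcases Nat.eq_zero_or_pos N with rfl | hN
    · simpa using hfN 0
    · have h1 := hsub.lim_le_div hbdd hN.ne'
      have hN' : (0 : ℝ) < N := by exact_mod_cast hN
      rw [le_div_iff₀ hN'] at h1
      rw [hr]
      linarith
  have hr0 : 0 ≤ r := by simpa using (Nat.cast_nonneg (f 1)).trans (hfr 1)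
  have hlow : ∀ ε > 0, ∃ C : ℝ, 0 ≤ C ∧ ∀ v, Lg v → (r - ε) * v.length - C ≤ occ w v := by
    intro ε hε
    have h1 := (hsub.tendsto_lim hbdd).eventually_lt_const
      (show hsub.lim < hsub.lim + ε by linarith)
    obtain ⟨N₀, hN₀⟩ := Filter.eventually_atTop.1 h1
    refine ⟨r * (N₀ + 1), by positivity, fun v hv => ?_⟩
    have h2 : (f v.length : ℝ) ≤ occ w v := by exact_mod_cast hfle v hv
    by_cases hv' : N₀ + 1 ≤ v.length
    · have h3 := hN₀ v.length (by omega)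
      have h4 : (0 : ℝ) < v.length := by
        have : 0 < v.length := by omega
        exact_mod_cast this
      rw [div_lt_iff₀ h4] at h3
      have h5 : (r - ε) * v.length = -((hsub.lim + ε) * v.length) := by rw [hr]; ring
      have : 0 ≤ r * ((N₀ : ℝ) + 1) := by positivity
      linarith
    · have h3 : (v.length : ℝ) ≤ N₀ + 1 := by
        have : v.length ≤ N₀ + 1 := by omega
        exact_mod_cast this
      have h4 := mul_le_mul_of_nonneg_left h3 hr0
      have h5 : 0 ≤ ε * (v.length : ℝ) := by positivity
      have h6 : (0 : ℝ) ≤ occ w v := Nat.cast_nonneg _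
      linarith
  refine ⟨r, fun ε hε => ?_⟩
  obtain ⟨C, hC0, hC⟩ := hlow (ε / (K + 1)) (by positivity)
  have hεK : ε / (K + 1) ≤ ε := div_le_self hε.le (by linarith [Nat.cast_nonneg (α := ℝ) K])
  refine ⟨2 * C, fun u hu => ⟨?_, ?_⟩⟩
  · have h1 := hC u hu
    have : ε / (K + 1) * (u.length : ℝ) ≤ ε * u.length :=
      mul_le_mul_of_nonneg_right hεK (Nat.cast_nonneg _)
    linarith
  · rcases eq_or_ne u [] with rfl | hu0
    · simpa [occ] using hC0
    obtain ⟨v, hv, hl, ho⟩ := hfmem (K * u.length)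
    obtain ⟨x, y, hxy⟩ := hK u v hu hv hu0 hl.ge
    have h1 := occ_add_occ_le w (x ++ u) y
    have h2 := occ_add_occ_le w x u
    rw [hxy, ho] at h1
    have h3 := hC x (hinf _ _ ⟨[], u ++ y, by simpa using hxy⟩ hv)
    have h4 := hC y (hinf _ _ ⟨x ++ u, [], by simpa using hxy⟩ hv)
    have h5 := hfr (K * u.length)
    have h6 : (occ w x + occ w u + occ w y : ℝ) ≤ f (K * u.length) := by
      exact_mod_cast (by omega : occ w x + occ w u + occ w y ≤ f (K * u.length))
    have h7 : (x.length + u.length + y.length : ℝ) = K * u.length := by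
      have := congrArg List.length hxy
      simp only [List.length_append, hl] at this
      exact_mod_cast this
    push_cast at h5
    have h8 : ε / (K + 1) * (x.length + y.length : ℝ) ≤ ε * u.length := by
      have : (x.length + y.length : ℝ) ≤ (K + 1) * u.length := by
        have := Nat.cast_nonneg (α := ℝ) u.length
        linarith
      calc ε / (K + 1) * (x.length + y.length : ℝ) ≤ ε / (K + 1) * ((K + 1) * u.length) :=
            mul_le_mul_of_nonneg_left this (by positivity)
        _ = ε * u.length := by
            have : (K + 1 : ℝ) ≠ 0 := by positivity
            field_simp
    have h9 : r * (K * u.length) = r * x.length + r * u.length + r * y.length := by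
      rw [← h7]; ring
    linarith

end WordSubstitution

namespace Matrix

variable {B : Type*} [Fintype B] [DecidableEq B] {M : Matrix B B ℝ}

theorem pow_mulVec_of_mulVec_eq {r : ℝ} {x : B → ℝ} (h : M *ᵥ x = r • x) (n : ℕ) :
    (M ^ n) *ᵥ x = r ^ n • x := by
  induction n with
  | zero => simp
  | succ n ih => rw [pow_succ, ← mulVec_mulVec, h, mulVec_smul, ih, smul_smul, pow_succ, mul_comm]

theorem pow_apply_nonneg_of_nonneg (h0 : ∀ i j, 0 ≤ M i j) (n : ℕ) (i j : B) :
    0 ≤ (M ^ n) i j := by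
  induction n generalizing i j with
  | zero => rw [pow_zero, one_apply]; split_ifs <;> norm_num
  | succ n ih =>
    rw [pow_succ, mul_apply]
    exact Finset.sum_nonneg fun k _ => mul_nonneg (ih _ _) (h0 _ _)

theorem mulVec_pos_of_exists_pow (h0 : ∀ i j, 0 ≤ M i j) {n : B → ℕ}
    (hn : ∀ i j, 0 < (M ^ n i) i j) {z : B → ℝ} (hz : ∀ i, 0 ≤ z i) (hz' : z ≠ 0) (i : B) :
    0 < ((∑ b, M ^ n b) *ᵥ z) i := by
  obtain ⟨j, hj⟩ := Function.ne_iff.1 hz'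
  rw [Matrix.sum_mulVec, Finset.sum_apply]
  have hnn : ∀ b, 0 ≤ ((M ^ n b) *ᵥ z) i := fun b =>
    Finset.sum_nonneg fun k _ => mul_nonneg (pow_apply_nonneg_of_nonneg h0 _ _ _) (hz k)
  refine Finset.sum_pos' (fun b _ => hnn b) ⟨i, Finset.mem_univ _, ?_⟩
  refine Finset.sum_pos' (fun k _ => mul_nonneg (hn i k).le (hz k)) ⟨j, Finset.mem_univ _, ?_⟩
  exact mul_pos (hn i j) ((hz j).lt_of_ne' hj)

/-- A positive eigenvector of a non-negative matrix belongs to the spectral radius. -/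
theorem norm_le_of_mem_spectrum_of_pos_eigenvector (h0 : ∀ i j, 0 ≤ M i j) {r : ℝ} {x : B → ℝ}
    (hx : ∀ i, 0 < x i) (h : M *ᵥ x = r • x) {z : ℂ}
    (hz : z ∈ spectrum ℂ (M.map ((↑) : ℝ → ℂ))) : ‖z‖ ≤ r := by
  rw [← Matrix.spectrum_toLin', ← Module.End.hasEigenvalue_iff_mem_spectrum] at hz
  obtain ⟨v, hv⟩ := hz.exists_hasEigenvector
  have hv1 := hv.apply_eq_smul
  obtain ⟨k, hk⟩ := Function.ne_iff.1 hv.2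
  have : Nonempty B := ⟨k⟩
  obtain ⟨i, hi⟩ := Finite.exists_max fun i => ‖v i‖ / x i
  have ht : 0 < ‖v i‖ / x i :=
    (div_pos (norm_pos_iff.2 hk) (hx k)).trans_le (hi k)
  have hle : ∀ j, ‖v j‖ ≤ ‖v i‖ / x i * x j := fun j => (div_le_iff₀ (hx j)).1 (hi j)
  have h1 : z * v i = ∑ j, (M i j : ℂ) * v j := by
    have := congrFun hv1 i
    simpa [toLin'_apply, mulVec, dotProduct] using this.symm
  have h2 : ‖z‖ * ‖v i‖ ≤ ∑ j, M i j * (‖v i‖ / x i * x j) := by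
    rw [← norm_mul, h1]
    refine (norm_sum_le _ _).trans (Finset.sum_le_sum fun j _ => ?_)
    rw [norm_mul, Complex.norm_real, Real.norm_of_nonneg (h0 i j)]
    exact mul_le_mul_of_nonneg_left (hle j) (h0 i j)
  have h3 : ∑ j, M i j * (‖v i‖ / x i * x j) = r * ‖v i‖ := by
    have := congrFun h i
    simp only [mulVec, dotProduct, Pi.smul_apply, smul_eq_mul] at this
    have e : ∀ j, M i j * (‖v i‖ / x i * x j) = ‖v i‖ / x i * (M i j * x j) := fun j => by ring
    simp_rw [e]
    rw [← Finset.mul_sum, this]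
    have := (hx i).ne'
    field_simp
  rw [h3] at h2
  have hvi : 0 < ‖v i‖ := by
    by_contra hc
    have : ‖v i‖ = 0 := le_antisymm (not_lt.1 hc) (norm_nonneg _)
    simp [this] at ht
  exact le_of_mul_le_mul_right h2 hvi

/-- Existence part of the Perron–Frobenius theorem. -/
theorem exists_isPerronFrobeniusVector [Nonempty B] (h0 : ∀ i j, 0 ≤ M i j)
    (hpos : ∀ i, ∃ n, 1 ≤ n ∧ ∀ j, 0 < (M ^ n) i j) : ∃ R, M.IsPerronFrobeniusVector R := by
  choose n hn1 hn using hpos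
  set C := ∑ i, ∑ j, M i j with hC
  let K : Set ((B → ℝ) × ℝ) := (stdSimplex ℝ B ×ˢ Set.Icc 0 C) ∩
    {p | ∀ i, p.2 * p.1 i ≤ (M *ᵥ p.1) i}
  have hKc : IsCompact K := by
    refine ((isCompact_stdSimplex (𝕜 := ℝ) B).prod isCompact_Icc).inter_right ?_
    simp only [Set.ofPred_forall]
    refine isClosed_iInter fun i => isClosed_le (by fun_prop) ?_
    simp only [mulVec, dotProduct]
    fun_prop
  have hC0 : 0 ≤ C := Finset.sum_nonneg fun i _ => Finset.sum_nonneg fun j _ => h0 i j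
  have hmul0 : ∀ x ∈ stdSimplex ℝ B, ∀ i, 0 ≤ (M *ᵥ x) i := fun x hx i =>
    Finset.sum_nonneg fun j _ => mul_nonneg (h0 i j) (hx.1 j)
  have hbd : ∀ x ∈ stdSimplex ℝ B, ∀ r : ℝ, (∀ i, r * x i ≤ (M *ᵥ x) i) → r ≤ C := by
    intro x hx r hr
    calc r = ∑ i, r * x i := by rw [← Finset.mul_sum, hx.2, mul_one]
      _ ≤ ∑ i, (M *ᵥ x) i := Finset.sum_le_sum fun i _ => hr i
      _ ≤ C := Finset.sum_le_sum fun i _ => Finset.sum_le_sum fun j _ => by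
        have : x j ≤ 1 := by
          rw [← hx.2]
          exact Finset.single_le_sum (fun k _ => hx.1 k) (Finset.mem_univ j)
        exact mul_le_of_le_one_right (h0 i j) this
  have hKne : K.Nonempty := by
    obtain ⟨b⟩ := ‹Nonempty B›
    refine ⟨(Pi.single b 1, 0), ⟨single_mem_stdSimplex ℝ b, le_rfl, hC0⟩, fun i => ?_⟩
    simpa only [zero_mul] using hmul0 _ (single_mem_stdSimplex ℝ b) i
  obtain ⟨⟨x, r⟩, ⟨⟨hx, hr⟩, hxr⟩, hmax⟩ := hKc.exists_isMaxOn hKne continuous_snd.continuousOn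
  simp only [Set.mem_ofPred_eq] at hx hr hxr
  set S := ∑ b, M ^ n b with hS
  have hSM : S * M = M * S := by
    rw [hS, Finset.sum_mul, Finset.mul_sum]
    exact Finset.sum_congr rfl fun b _ => (Commute.pow_self M _).eq
  have hx0 : x ≠ 0 := by
    rintro rfl
    have := hx.2
    simp at this
  have hy := mulVec_pos_of_exists_pow h0 hn hx.1 hx0
  have heig : M *ᵥ x = r • x := by
    by_contra hne
    have hz := mulVec_pos_of_exists_pow h0 hn (z := M *ᵥ x - r • x)
      (fun i => by simpa using hxr i) (sub_ne_zero.2 hne)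
    rw [← hS] at hy hz
    have hSz : S *ᵥ (M *ᵥ x - r • x) = M *ᵥ (S *ᵥ x) - r • (S *ᵥ x) := by
      rw [mulVec_sub, mulVec_mulVec, hSM, mulVec_smul, mulVec_mulVec]
    rw [hSz] at hz
    set y := S *ᵥ x
    obtain ⟨i₀, hi₀⟩ := Finite.exists_min fun i => (M *ᵥ y - r • y) i / y i
    set δ := (M *ᵥ y - r • y) i₀ / y i₀
    have hδ : 0 < δ := div_pos (hz i₀) (hy i₀)
    have hs : 0 < ∑ i, y i := Finset.sum_pos (fun i _ => hy i) Finset.univ_nonempty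
    have hy' : (∑ i, y i)⁻¹ • y ∈ stdSimplex ℝ B :=
      ⟨fun i => mul_nonneg (inv_nonneg.2 hs.le) (hy i).le, by
        simp [← Finset.mul_sum, hs.ne']⟩
    have hle : ∀ i, (r + δ) * ((∑ i, y i)⁻¹ • y) i ≤ (M *ᵥ ((∑ i, y i)⁻¹ • y)) i := by
      intro i
      have h1 := (le_div_iff₀ (hy i)).1 (hi₀ i)
      simp only [Pi.sub_apply, Pi.smul_apply, smul_eq_mul, mulVec_smul] at h1 ⊢
      have h2 : (r + δ) * y i ≤ (M *ᵥ y) i := by linarith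
      have := mul_le_mul_of_nonneg_left h2 (inv_nonneg.2 hs.le)
      linarith
    have hmem : ((∑ i, y i)⁻¹ • y, r + δ) ∈ K :=
      ⟨⟨hy', by have := hr.1; linarith, hbd _ hy' _ hle⟩, hle⟩
    have := hmax hmem
    simp only [Set.mem_ofPred_eq] at this
    linarith
  have hxpos : ∀ i, 0 < x i := by
    intro i
    have h1 := hy i
    rw [Matrix.sum_mulVec, Finset.sum_apply] at h1
    simp only [pow_mulVec_of_mulVec_eq heig, Pi.smul_apply, smul_eq_mul, ← Finset.sum_mul] at h1
    exact (hx.1 i).lt_of_ne' fun h => by simp [h] at h1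
  have hrpos : 0 < r := by
    refine hr.1.lt_of_ne' fun h => ?_
    obtain ⟨b⟩ := ‹Nonempty B›
    have h1 : 0 < ((M ^ n b) *ᵥ x) b :=
      Finset.sum_pos (fun j _ => mul_pos (hn b j) (hxpos j)) ⟨b, Finset.mem_univ _⟩
    rw [pow_mulVec_of_mulVec_eq heig, h, zero_pow (by have := hn1 b; omega)] at h1
    simp at h1
  exact ⟨x, hxpos, hx.2, r, hrpos,
    fun z hz => norm_le_of_mem_spectrum_of_pos_eigenvector h0 hxpos heig hz, heig⟩

end Matrix

namespace RandomSubstitution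

variable {A : Type*} {θ : RandomSubstitution A}

theorem IsRealisation.length_le {u z : List A} (h : θ.IsRealisation u z) :
    u.length ≤ z.length := by
  induction h with
  | nil => simp
  | cons hw _ ih =>
    have := List.length_pos_of_ne_nil (θ.ne_nil _ _ hw)
    simp only [List.length_cons, List.length_append]
    omega

/-! ### Expected values over realisations -/

namespace Probabilities

/-- The expected value of `F` at a random realisation of the word `u`. -/
def expect (P : θ.Probabilities) : List A → (List A → ℝ) → ℝ
  | [], F => F []
  | a :: u, F => ∑ w : θ.words a, P.prob a w * P.expect u fun v => F (w.1 ++ v)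

variable (P : θ.Probabilities)

theorem expect_const (u : List A) (r : ℝ) : P.expect u (fun _ => r) = r := by
  induction u with
  | nil => rfl
  | cons a u ih => rw [expect, ih, ← Finset.sum_mul, P.sum_eq_one, one_mul]

theorem expect_add (u : List A) (F G : List A → ℝ) :
    P.expect u (fun z => F z + G z) = P.expect u F + P.expect u G := by
  induction u generalizing F G with
  | nil => rfl
  | cons a u ih => simp only [expect, ih, mul_add, Finset.sum_add_distrib]

theorem expect_append (u v : List A) (F : List A → ℝ) :
    P.expect (u ++ v) F = P.expect u fun x => P.expect v fun y => F (x ++ y) := by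
  induction u generalizing F with
  | nil => rfl
  | cons a u ih => simp only [List.cons_append, expect, ih, List.append_assoc]

variable {P} in
theorem expect_le {u : List A} {F G : List A → ℝ} (h : ∀ z, θ.IsRealisation u z → F z ≤ G z) :
    P.expect u F ≤ P.expect u G := by
  induction u generalizing F G with
  | nil => exact h _ .nil
  | cons a u ih =>
    exact Finset.sum_le_sum fun w _ => mul_le_mul_of_nonneg_left
      (ih fun z hz => h _ (.cons w.2 hz)) (P.nonneg a w)

variable {P} in
theorem expect_congr {u : List A} {F G : List A → ℝ}
    (h : ∀ z, θ.IsRealisation u z → F z = G z) : P.expect u F = P.expect u G :=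
  le_antisymm (expect_le fun z hz => (h z hz).le) (expect_le fun z hz => (h z hz).ge)

variable {P} in
theorem expect_nonneg {u : List A} {F : List A → ℝ} (h : ∀ z, θ.IsRealisation u z → 0 ≤ F z) :
    0 ≤ P.expect u F :=
  (P.expect_const u 0).ge.trans (expect_le h)

variable {P} in
theorem expect_pos (hP : P.NonDegenerate) {u z : List A} {F : List A → ℝ} (h : ∀ z, 0 ≤ F z)
    (hz : θ.IsRealisation u z) (hF : 0 < F z) : 0 < P.expect u F := by
  induction hz generalizing F with
  | nil => exact hF
  | @cons a w u v hw _ ih =>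
    refine Finset.sum_pos' (fun w _ => mul_nonneg (P.nonneg a w) (expect_nonneg fun z _ => h _))
      ⟨⟨w, hw⟩, Finset.mem_univ _, mul_pos ((P.nonneg a _).lt_of_ne' (hP a _)) ?_⟩
    exact ih (fun z => h _) hF

end Probabilities

/-! ### The transfer operator -/

/-- The sum of `h` over the subwords of length `ℓ` of `v` starting at the first `m` positions. -/
def blockSum (ℓ : ℕ) (h : List A → ℝ) (v : List A) (m : ℕ) : ℝ :=
  ∑ q ∈ Finset.range m, h ((v.drop q).take ℓ)

theorem blockSum_append_add (ℓ : ℕ) (h : List A → ℝ) (w z : List A) (j : ℕ) :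
    blockSum ℓ h (w ++ z) (w.length + j) =
      blockSum ℓ h (w ++ z) w.length + blockSum ℓ h z j := by
  simp only [blockSum, Finset.sum_range_add, ← List.drop_drop, List.drop_left]

theorem blockSum_append_of_le {ℓ m : ℕ} (h : List A → ℝ) {v : List A} (v' : List A)
    (hm : m + ℓ ≤ v.length + 1) : blockSum ℓ h (v ++ v') m = blockSum ℓ h v m := by
  refine Finset.sum_congr rfl fun q hq => ?_
  have := Finset.mem_range.1 hq
  rw [List.drop_append_of_le_length (by omega), List.take_append_of_le_length]
  rw [List.length_drop]
  omega

theorem blockSum_nonneg {ℓ : ℕ} {h : List A → ℝ} (hh : ∀ u, 0 ≤ h u) (v : List A) (m : ℕ) :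
    0 ≤ blockSum ℓ h v m :=
  Finset.sum_nonneg fun _ _ => hh _

namespace Probabilities

variable (P : θ.Probabilities)

/-- The expected value of the sum of `h` over the letters of the image of the word `u` of length
`ℓ` under the induced substitution `θ_ℓ`. -/
def transfer (ℓ : ℕ) (h : List A → ℝ) : List A → ℝ
  | [] => 0
  | a :: u => ∑ w : θ.words a, P.prob a w *
      P.expect u fun z => blockSum ℓ h (w.1 ++ z) w.1.length

theorem transfer_nonneg {ℓ : ℕ} {h : List A → ℝ} (hh : ∀ u, 0 ≤ h u) (u : List A) :
    0 ≤ P.transfer ℓ h u := by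
  cases u with
  | nil => exact le_rfl
  | cons a u => exact Finset.sum_nonneg fun w _ =>
      mul_nonneg (P.nonneg a w) (expect_nonneg fun z _ => blockSum_nonneg hh _ _)

theorem expect_take {ℓ : ℕ} (hℓ : 1 ≤ ℓ) (h : List A → ℝ) {v : List A} (hv : ℓ ≤ v.length + 1)
    (w : List A) :
    P.expect (v.take (ℓ - 1)) (fun z => blockSum ℓ h (w ++ z) w.length) =
      P.expect v fun z => blockSum ℓ h (w ++ z) w.length := by
  conv_rhs => rw [← List.take_append_drop (ℓ - 1) v, expect_append]
  refine expect_congr fun x hx => ?_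
  have hl := hx.length_le
  rw [List.length_take, min_eq_left (by omega)] at hl
  have : ∀ y, blockSum ℓ h (w ++ (x ++ y)) w.length = blockSum ℓ h (w ++ x) w.length := fun y => by
    rw [← List.append_assoc]
    refine blockSum_append_of_le h y ?_
    rw [List.length_append]
    omega
  simp only [this, expect_const]

/-- Summing `transfer` over the subwords of `v` amounts to summing `h` over the subwords of a random
realisation of `v`. -/
theorem blockSum_transfer {ℓ : ℕ} (hℓ : 1 ≤ ℓ) (h : List A → ℝ) {v : List A} {m : ℕ}
    (hm : m + ℓ ≤ v.length + 1) :
    blockSum ℓ (P.transfer ℓ h) v m =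
      P.expect (v.take m) fun x => P.expect (v.drop m) fun y => blockSum ℓ h (x ++ y) x.length := by
  induction m generalizing v with
  | zero => simp [blockSum, expect, expect_const]
  | succ m ih =>
    match v with
    | [] => simp only [List.length_nil] at hm; omega
    | a :: v =>
      simp only [List.length_cons] at hm
      have h1 : blockSum ℓ (P.transfer ℓ h) (a :: v) (m + 1) =
          blockSum ℓ (P.transfer ℓ h) v m + P.transfer ℓ h (a :: v.take (ℓ - 1)) := by
        obtain ⟨ℓ, rfl⟩ := Nat.exists_eq_add_of_le' hℓ
        simp only [blockSum, Finset.sum_range_succ', List.drop_succ_cons, List.drop_zero,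
          List.take_succ_cons, Nat.add_sub_cancel]
      rw [h1, ih (by omega)]
      simp only [List.take_succ_cons, List.drop_succ_cons, expect, transfer,
        P.expect_take hℓ h (v := v) (by omega), List.length_append, List.append_assoc,
        blockSum_append_add, expect_add]
      simp only [mul_add, Finset.sum_add_distrib, ← Finset.sum_mul, P.sum_eq_one, one_mul]
      rw [add_comm]
      congr 1
      refine Finset.sum_congr rfl fun w _ => ?_
      conv_lhs => rw [← List.take_append_drop m v, expect_append]

theorem blockSum_transfer_le {ℓ : ℕ} (hℓ : 1 ≤ ℓ) {h : List A → ℝ} {C : ℝ}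
    (hC : ∀ v m, θ.IsLegal v → m + ℓ ≤ v.length + 1 → blockSum ℓ h v m ≤ C)
    (v : List A) (m : ℕ) (hv : θ.IsLegal v) (hm : m + ℓ ≤ v.length + 1) :
    blockSum ℓ (P.transfer ℓ h) v m ≤ C := by
  rw [P.blockSum_transfer hℓ h hm, ← P.expect_const (v.take m) C]
  refine expect_le fun x hx => ?_
  rw [← P.expect_const (v.drop m) C]
  refine expect_le fun y hy => hC _ _ ?_ ?_
  · have := hx.append hy
    rw [List.take_append_drop] at this
    exact hv.of_isRealisation this (List.infix_refl _)
  · have := hy.length_le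
    rw [List.length_drop] at this
    rw [List.length_append]
    omega

variable {P} in
theorem blockSum_iterate_transfer_pos (hP : P.NonDegenerate) {ℓ : ℕ} (hℓ : 1 ≤ ℓ)
    {h : List A → ℝ} (hh : ∀ u, 0 ≤ h u) {n : ℕ} {s t x y : List A}
    (hx : θ.IsPowRealisation n s x) (hy : θ.IsPowRealisation n t y) (ht : ℓ ≤ t.length + 1)
    (hpos : 0 < blockSum ℓ h (x ++ y) x.length) :
    0 < blockSum ℓ ((P.transfer ℓ)^[n] h) (s ++ t) s.length := by
  induction n generalizing h x y with
  | zero =>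
    obtain rfl : x = s := hx
    obtain rfl : y = t := hy
    exact hpos
  | succ n ih =>
    obtain ⟨x', hx', hx⟩ := hx
    obtain ⟨y', hy', hy⟩ := hy
    have hlen : ∀ {n} {t y' : List A}, θ.IsPowRealisation n t y' → t.length ≤ y'.length := by
      intro n
      induction n with
      | zero => rintro t y' rfl; exact le_rfl
      | succ n ih =>
        rintro t y' ⟨z, hz, hz'⟩
        exact (ih hz).trans hz'.length_le
    have := hlen hy'
    refine ih (P.transfer_nonneg hh) hx' hy' ?_
    rw [P.blockSum_transfer hℓ h (by rw [List.length_append]; omega), List.take_left,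
      List.drop_left]
    refine expect_pos hP (fun z => expect_nonneg fun y _ => blockSum_nonneg hh _ _) hx ?_
    exact expect_pos hP (fun z => blockSum_nonneg hh _ _) hy hpos

/-! ### The transfer operator and the induced substitution matrix -/

theorem sum_choice {ℓ : ℕ} (u : Fin ℓ → A) (F : List A → ℝ) :
    ∑ c : θ.Choice u, (∏ i, P.prob (u i) (c i)) * F c.word = P.expect (List.ofFn u) F := by
  induction ℓ generalizing F with
  | zero => simp [Choice.word, expect]
  | succ ℓ ih =>
    rw [List.ofFn_succ, expect, ← (Fin.consEquiv fun i => θ.words (u i)).sum_comp,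
      Fintype.sum_prod_type]
    refine Finset.sum_congr rfl fun w _ => ?_
    rw [← ih, Finset.mul_sum]
    refine Finset.sum_congr rfl fun c _ => ?_
    rw [Fin.prod_univ_succ, mul_assoc]
    simp [Choice.word, List.ofFn_succ, Fin.consEquiv]

end Probabilities

theorem ofFn_blocks {ℓ : ℕ} [NeZero ℓ] (u : θ.LegalWord ℓ) (c : θ.Choice u.1) :
    (Choice.blocks u c).map (fun w => List.ofFn w.1) =
      (List.range (c 0).1.length).map fun q => (c.word.drop q).take ℓ := by
  apply List.ext_getElem
  · simp [Choice.blocks]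
  · intro k h1 h2
    have hk : k < (c 0).1.length := by simpa using h2
    have hl := c.length_le
    apply List.ext_getElem
    · simp only [List.getElem_map, List.length_ofFn, List.getElem_range, List.length_take,
        List.length_drop]
      omega
    · intro i h3 h4
      simp [Choice.blocks]

theorem sum_count_mul {B : Type*} [Fintype B] [DecidableEq B] (l : List B) (H : B → ℝ) :
    ∑ b, (l.count b : ℝ) * H b = (l.map H).sum := by
  induction l with
  | nil => simp
  | cons a l ih =>
    simp [List.count_cons, add_mul, Finset.sum_add_distrib, ih, add_comm]

namespace Probabilities

theorem induced_matrix_apply [DecidableEq A] (P : θ.Probabilities) {ℓ : ℕ} [NeZero ℓ] (w u : θ.LegalWord ℓ) :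
    (P.induced ℓ).matrix w u =
      ∑ c : θ.Choice u.1, (∏ i, P.prob (u.1 i) (c i)) * (@List.count _ instBEqOfDecidableEq w (Choice.blocks u c) : ℝ) := by
  rw [← Finset.sum_fiberwise_of_maps_to (s := Finset.univ)
      (t := (θ.induced ℓ).words u) (g := Choice.blocks u)
      (fun c _ => Finset.mem_image_of_mem _ (Finset.mem_univ c)),
    ← Finset.sum_coe_sort ((θ.induced ℓ).words u)]
  refine Finset.sum_congr rfl fun x _ => ?_
  rw [induced, Finset.sum_mul]
  refine Finset.sum_congr rfl fun c hc => ?_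
  rw [(Finset.mem_filter.1 hc).2]

variable [Fintype A] [DecidableEq A] (P : θ.Probabilities)

theorem sum_induced_matrix_mul {ℓ : ℕ} [NeZero ℓ] (h : List A → ℝ) (u : θ.LegalWord ℓ) :
    ∑ w : θ.LegalWord ℓ, (P.induced ℓ).matrix w u * h (List.ofFn w.1) =
      P.transfer ℓ h (List.ofFn u.1) := by
  have h1 : ∀ c : θ.Choice u.1,
      ∑ w : θ.LegalWord ℓ,
        (@List.count _ instBEqOfDecidableEq w (Choice.blocks u c) : ℝ) * h (List.ofFn w.1) =
        blockSum ℓ h c.word (c 0).1.length := by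
    intro c
    rw [sum_count_mul (Choice.blocks u c) fun w => h (List.ofFn w.1)]
    have := congrArg (fun l => (l.map h).sum) (ofFn_blocks u c)
    simp only [List.map_map, Function.comp_def] at this
    rw [this]
    rfl
  simp_rw [induced_matrix_apply, Finset.sum_mul, mul_assoc]
  rw [Finset.sum_comm]
  simp_rw [← Finset.mul_sum, h1]
  obtain ⟨u, hu⟩ := u
  obtain _ | ℓ := ℓ
  · exact absurd rfl (NeZero.ne 0)
  rw [List.ofFn_succ, transfer, ← (Fin.consEquiv fun i => θ.words (u i)).sum_comp,
    Fintype.sum_prod_type]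
  refine Finset.sum_congr rfl fun w _ => ?_
  rw [← sum_choice, Finset.mul_sum]
  refine Finset.sum_congr rfl fun c _ => ?_
  rw [Fin.prod_univ_succ, mul_assoc]
  simp [Choice.word, List.ofFn_succ, Fin.consEquiv]

end Probabilities

end RandomSubstitution

namespace RandomSubstitution

variable {A : Type*} {θ : RandomSubstitution A}

/-! ### Realisations of powers and legal words -/

theorem IsPowRealisation.append {n : ℕ} {u v u' v' : List A} (h : θ.IsPowRealisation n u v)
    (h' : θ.IsPowRealisation n u' v') : θ.IsPowRealisation n (u ++ u') (v ++ v') := by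
  induction n generalizing v v' with
  | zero =>
    obtain rfl : v = u := h
    obtain rfl : v' = u' := h'
    rfl
  | succ n ih =>
    obtain ⟨x, hx, hxv⟩ := h
    obtain ⟨x', hx', hxv'⟩ := h'
    exact ⟨x ++ x', ih hx hx', hxv.append hxv'⟩

theorem IsPowRealisation.trans {m n : ℕ} {u v w : List A} (h : θ.IsPowRealisation m u v)
    (h' : θ.IsPowRealisation n v w) : θ.IsPowRealisation (m + n) u w := by
  induction n generalizing w with
  | zero =>
    obtain rfl : w = v := h'
    exact h
  | succ n ih =>
    obtain ⟨x, hx, hxw⟩ := h'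
    exact ⟨x, ih hx, hxw⟩

theorem exists_isPowRealisation (θ : RandomSubstitution A) (n : ℕ) (u : List A) :
    ∃ v, θ.IsPowRealisation n u v := by
  induction n with
  | zero => exact ⟨u, rfl⟩
  | succ n ih =>
    obtain ⟨v, hv⟩ := ih
    obtain ⟨w, hw⟩ := θ.exists_isRealisation v
    exact ⟨w, v, hv, hw⟩

theorem IsPowRealisation.length_le {n : ℕ} {u v : List A} (h : θ.IsPowRealisation n u v) :
    u.length ≤ v.length := by
  induction n generalizing v with
  | zero =>
    obtain rfl : v = u := h
    exact le_rfl
  | succ n ih =>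
    obtain ⟨x, hx, hxv⟩ := h
    exact (ih hx).trans hxv.length_le

theorem IsPowRealisation.exists_of_infix {m n : ℕ} {u v w y : List A}
    (h : θ.IsPowRealisation m u v) (hw : w <:+: v) (h' : θ.IsPowRealisation n w y) :
    ∃ z, θ.IsPowRealisation (m + n) u z ∧ y <:+: z := by
  obtain ⟨s, t, rfl⟩ := hw
  obtain ⟨s', hs⟩ := θ.exists_isPowRealisation n s
  obtain ⟨t', ht⟩ := θ.exists_isPowRealisation n t
  exact ⟨s' ++ y ++ t', h.trans ((hs.append h').append ht), s', t', rfl⟩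

theorem IsSubwordPow.trans {m n : ℕ} {u v w : List A} (h : θ.IsSubwordPow m v w)
    (h' : θ.IsSubwordPow n u v) : θ.IsSubwordPow (m + n) u w := by
  obtain ⟨x, hx, hvx⟩ := h
  obtain ⟨y, hy, huy⟩ := h'
  obtain ⟨z, hz, hyz⟩ := hx.exists_of_infix hvx hy
  exact ⟨z, hz, huy.trans hyz⟩

theorem IsLegal.of_infix {u v : List A} (hv : θ.IsLegal v) (h : u <:+: v) : θ.IsLegal u := by
  obtain ⟨k, hk, a, x, hx, hvx⟩ := hv
  exact ⟨k, hk, a, x, hx, h.trans hvx⟩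

theorem IsLegal.of_isPowRealisation {n : ℕ} {u v : List A} (hu : θ.IsLegal u)
    (h : θ.IsPowRealisation n u v) : θ.IsLegal v := by
  obtain ⟨k, hk, a, x, hx, hux⟩ := hu
  obtain ⟨z, hz, hvz⟩ := hx.exists_of_infix hux h
  exact ⟨k + n, by omega, a, z, hz, hvz⟩

theorem IsPrimitive.isLegal_singleton (hθ : θ.IsPrimitive) (a : A) : θ.IsLegal [a] := by
  obtain ⟨k, hk, h⟩ := hθ
  exact ⟨k, hk, a, h a a⟩

theorem length_subwordAt (x : ℤ → A) (k : ℤ) (ℓ : ℕ) : (subwordAt x k ℓ).length = ℓ := by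
  simp [subwordAt]

/-- There are realisations of every length of some common power, from every letter. -/
theorem IsPrimitive.exists_length_le (hθ : θ.IsPrimitive)
    (hlong : ∀ N, ∃ v, θ.IsLegal v ∧ v.length = N) (N : ℕ) :
    ∃ n, ∀ b, ∃ z, θ.IsPowRealisation n [b] z ∧ N ≤ z.length := by
  obtain ⟨k, hk, hkk⟩ := hθ
  obtain ⟨v, ⟨j, -, a, hv⟩, rfl⟩ := hlong N
  refine ⟨k + j, fun b => ?_⟩
  obtain ⟨z, hz, hvz⟩ := (hkk a b).trans hv
  exact ⟨z, hz, hvz.length_le⟩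

theorem exists_isPowRealisation_subset {k : ℕ} (hk : ∀ a b, θ.IsSubwordPow k [a] [b])
    {z t : List A} (h : t.length ≤ z.length) :
    ∃ y, θ.IsPowRealisation k z y ∧ ∀ a ∈ t, a ∈ y := by
  induction t generalizing z with
  | nil =>
    obtain ⟨y, hy⟩ := θ.exists_isPowRealisation k z
    exact ⟨y, hy, by simp⟩
  | cons a t ih =>
    match z with
    | [] => simp at h
    | c :: z =>
      obtain ⟨y, hy, hyt⟩ := ih (z := z) (by simpa using h)
      obtain ⟨x, hx, hax⟩ := hk a c
      refine ⟨x ++ y, hx.append hy, ?_⟩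
      rintro b hb
      rcases List.mem_cons.1 hb with rfl | hb
      · exact List.mem_append_left _ (hax.subset (by simp))
      · exact List.mem_append_right _ (hyt b hb)

/-- Some power of a primitive random substitution has a positive marginal. -/
theorem IsPrimitive.exists_isPositive [Fintype A] (hθ : θ.IsPrimitive)
    (hlong : ∀ N, ∃ v, θ.IsLegal v ∧ v.length = N) :
    ∃ (n : ℕ) (τ : A → List A), WordSubstitution.IsPositive τ ∧
      ∀ a, θ.IsPowRealisation n [a] (τ a) := by
  obtain ⟨n, hn⟩ := hθ.exists_length_le hlong (Fintype.card A + 2)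
  obtain ⟨k, -, hk⟩ := hθ
  have : ∀ b, ∃ y, θ.IsPowRealisation (n + k) [b] y ∧ (∀ a, a ∈ y) ∧ 2 ≤ y.length := by
    intro b
    obtain ⟨z, hz, hzl⟩ := hn b
    obtain ⟨y, hy, hy'⟩ := exists_isPowRealisation_subset hk (z := z)
      (t := Finset.univ.toList) (by rw [Finset.length_toList, Finset.card_univ]; omega)
    exact ⟨y, hz.trans hy, fun a => hy' a (by simp), by have := hy.length_le; omega⟩
  choose τ h1 h2 h3 using this
  exact ⟨n + k, τ, ⟨h2, h3⟩, h1⟩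

theorem isPowRealisation_flatMap {n : ℕ} {τ : A → List A}
    (hτ : ∀ a, θ.IsPowRealisation n [a] (τ a)) (u : List A) :
    θ.IsPowRealisation n u (u.flatMap τ) := by
  induction u with
  | nil =>
    clear hτ
    induction n with
    | zero => rfl
    | succ n ih => exact ⟨[], ih, .nil⟩
  | cons a u ih => exact (hτ a).append ih

theorem IsPrimitive.isLegal_of_generates (hθ : θ.IsPrimitive) {n : ℕ} {τ : A → List A}
    (hτ : ∀ a, θ.IsPowRealisation n [a] (τ a)) {w : List A}
    (hw : WordSubstitution.Generates τ w) : θ.IsLegal w := by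
  obtain ⟨m, c, hw⟩ := hw
  refine IsLegal.of_infix ?_ hw
  clear hw
  induction m with
  | zero => exact hθ.isLegal_singleton c
  | succ m ih => exact ih.of_isPowRealisation (isPowRealisation_flatMap hτ _)

/-- Every letter is the first letter of legal words of every positive length. -/
theorem IsPrimitive.exists_isLegal_cons (hθ : θ.IsPrimitive)
    (hlong : ∀ N, ∃ v, θ.IsLegal v ∧ v.length = N) (a : A) (ℓ : ℕ) :
    ∃ t, θ.IsLegal (a :: t) ∧ t.length = ℓ := by
  obtain ⟨k, -, hk⟩ := hθ
  obtain ⟨v, hv, hvl⟩ := hlong (ℓ + 1)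
  match v with
  | [] => simp at hvl
  | c :: v =>
    obtain ⟨x, hx, s, t, rfl⟩ := hk a c
    obtain ⟨y, hy⟩ := θ.exists_isPowRealisation k v
    have hyl := hy.length_le
    have hleg := hv.of_isPowRealisation (hx.append hy)
    refine ⟨(t ++ y).take ℓ, hleg.of_infix ?_, ?_⟩
    · have : (a :: (t ++ y).take ℓ) <+: a :: (t ++ y) :=
        (List.prefix_cons_inj a).2 (List.take_prefix _ _)
      exact this.isInfix.trans ⟨s, [], by simp⟩
    · simp only [List.length_cons] at hvl
      rw [List.length_take, List.length_append]
      omega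

theorem IsRealisation.length_eq {u v : List A} (h : θ.IsRealisation u v)
    (h1 : ∀ a, ∀ w ∈ θ.words a, w.length = 1) : v.length = u.length := by
  induction h with
  | nil => rfl
  | cons hw _ ih => rw [List.length_append, h1 _ _ hw, ih, List.length_cons, add_comm]

theorem exists_two_le_length (hlong : ∀ N, ∃ v, θ.IsLegal v ∧ v.length = N) :
    ∃ a, ∃ w ∈ θ.words a, 2 ≤ w.length := by
  by_contra! hc
  have h1 : ∀ a, ∀ w ∈ θ.words a, w.length = 1 := fun a w hw => by
    have := hc a w hw
    have := List.length_pos_of_ne_nil (θ.ne_nil a w hw)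
    omega
  obtain ⟨v, ⟨k, -, a, x, hx, hvx⟩, hv⟩ := hlong 2
  have : ∀ n y, θ.IsPowRealisation n [a] y → y.length = 1 := by
    intro n
    induction n with
    | zero => rintro y rfl; rfl
    | succ n ih =>
      rintro y ⟨z, hz, hzy⟩
      rw [hzy.length_eq h1, ih z hz]
  have := this k x hx
  have := hvx.length_le
  omega

/-! ### Perron–Frobenius vectors of the induced substitution matrices -/

theorem LegalWord.length_ofFn {ℓ : ℕ} (u : θ.LegalWord ℓ) : (List.ofFn u.1).length = ℓ :=
  List.length_ofFn

theorem exists_legalWord {u : List A} (hu : θ.IsLegal u) :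
    ∃ v : θ.LegalWord u.length, List.ofFn v.1 = u :=
  ⟨⟨u.get, by simpa using hu⟩, by simp⟩

theorem LegalWord.ofFn_injective {ℓ : ℕ} {u v : θ.LegalWord ℓ}
    (h : List.ofFn u.1 = List.ofFn v.1) : u = v :=
  Subtype.ext (List.ofFn_injective h)

namespace Probabilities

section matrix

variable [Fintype A] [DecidableEq A] (P : θ.Probabilities) {ℓ : ℕ} [NeZero ℓ]

theorem sum_induced_matrix_pow_mul (h : List A → ℝ) (n : ℕ) (u : θ.LegalWord ℓ) :
    ∑ w : θ.LegalWord ℓ, ((P.induced ℓ).matrix ^ n) w u * h (List.ofFn w.1) =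
      (P.transfer ℓ)^[n] h (List.ofFn u.1) := by
  induction n generalizing u with
  | zero => simp [Matrix.one_apply]
  | succ n ih =>
    rw [Function.iterate_succ_apply', ← sum_induced_matrix_mul]
    simp_rw [pow_succ, Matrix.mul_apply, Finset.sum_mul, ← ih, Finset.mul_sum]
    rw [Finset.sum_comm]
    exact Finset.sum_congr rfl fun _ _ => Finset.sum_congr rfl fun _ _ => by ring

theorem induced_matrix_pow_apply (n : ℕ) (w u : θ.LegalWord ℓ) :
    ((P.induced ℓ).matrix ^ n) w u =
      (P.transfer ℓ)^[n] (fun x => if x = List.ofFn w.1 then 1 else 0) (List.ofFn u.1) := by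
  rw [← sum_induced_matrix_pow_mul, Finset.sum_eq_single w]
  · simp
  · intro v _ hv
    rw [if_neg fun h => hv (LegalWord.ofFn_injective h), mul_zero]
  · simp

variable {P} in
theorem exists_isPerronFrobeniusVector (hP : P.NonDegenerate) (hθ : θ.IsPrimitive)
    (hlong : ∀ N, ∃ v, θ.IsLegal v ∧ v.length = N) :
    ∃ R, (P.induced ℓ).matrix.IsPerronFrobeniusVector R := by
  have hℓ : 1 ≤ ℓ := NeZero.one_le
  have : Nonempty (θ.LegalWord ℓ) := by
    obtain ⟨v, hv, rfl⟩ := hlong ℓ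
    exact ⟨(exists_legalWord hv).choose⟩
  have hnn : ∀ w : θ.LegalWord ℓ, ∀ x, (0 : ℝ) ≤ if x = List.ofFn w.1 then 1 else 0 :=
    fun w x => by split_ifs <;> norm_num
  refine Matrix.exists_isPerronFrobeniusVector (fun w u => ?_) fun w => ?_
  · rw [← pow_one (P.induced ℓ).matrix, induced_matrix_pow_apply]
    exact P.transfer_nonneg (hnn w) _
  · obtain ⟨k, hk, hkk⟩ := hθ
    obtain ⟨n, hn, a, hw⟩ := w.2
    refine ⟨k + n, by omega, fun u => ?_⟩
    have hul := LegalWord.length_ofFn u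
    rw [induced_matrix_pow_apply]
    match hu : List.ofFn u.1, hul with
    | [], hul => simp only [List.length_nil] at hul; omega
    | b :: t, hul =>
      obtain ⟨x, hx, s, r, hsr⟩ := (hkk a b).trans hw
      obtain ⟨y, hy⟩ := θ.exists_isPowRealisation (k + n) t
      have := blockSum_iterate_transfer_pos hP hℓ (hnn w) hx hy
        (by simp only [List.length_cons] at hul; omega) ?_
      · simpa [blockSum, List.take_of_length_le hul.le] using this
      · refine Finset.sum_pos' (fun _ _ => hnn w _) ⟨s.length, ?_, ?_⟩
        · rw [Finset.mem_range, ← hsr]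
          simp only [List.length_append, List.length_ofFn]
          omega
        · rw [← hsr, List.append_assoc, List.append_assoc, List.drop_left, List.take_left']
          · simp
          · simp

variable {P} in
theorem rightVector_spec (hP : P.NonDegenerate) (hθ : θ.IsPrimitive)
    (hlong : ∀ N, ∃ v, θ.IsLegal v ∧ v.length = N) :
    (P.induced ℓ).matrix.IsPerronFrobeniusVector (P.rightVector ℓ) := by
  have h := exists_isPerronFrobeniusVector (P := P) (ℓ := ℓ) hP hθ hlong
  rw [rightVector, dif_pos h]
  exact h.choose_spec

end matrix

theorem transfer_one (P : θ.Probabilities) (ℓ : ℕ) (a : A) (u : List A) :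
    P.transfer ℓ (fun _ => 1) (a :: u) = ∑ w : θ.words a, P.prob a w * w.1.length := by
  simp [transfer, blockSum, expect_const]

section eigen

variable [Fintype A] {P : θ.Probabilities} {ℓ : ℕ} {R : θ.LegalWord ℓ → ℝ} {r : ℝ}

/-- `R` is a left eigenvector of the transfer operator, i.e. a right eigenvector of the induced
substitution matrix, for the eigenvalue `r`. -/
def IsEigenvector (P : θ.Probabilities) (R : θ.LegalWord ℓ → ℝ) (r : ℝ) : Prop :=
  ∀ h : List A → ℝ, ∑ u, R u * P.transfer ℓ h (List.ofFn u.1) = r * ∑ u, R u * h (List.ofFn u.1)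

theorem isEigenvector_of_isPerronFrobeniusVector [DecidableEq A] [NeZero ℓ]
    (hR : (P.induced ℓ).matrix.IsPerronFrobeniusVector R) : ∃ r, P.IsEigenvector R r := by
  obtain ⟨-, -, r, -, -, hr⟩ := hR
  refine ⟨r, fun h => ?_⟩
  have h1 : ∀ w, ∑ u, (P.induced ℓ).matrix w u * R u = r * R w := fun w => by
    simpa [Matrix.mulVec, dotProduct] using congrFun hr w
  simp_rw [← sum_induced_matrix_mul, Finset.mul_sum]
  rw [Finset.sum_comm]
  refine Finset.sum_congr rfl fun w _ => ?_
  rw [← mul_assoc, ← h1, Finset.sum_mul]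
  exact Finset.sum_congr rfl fun u _ => by ring

theorem IsEigenvector.iterate (hr : P.IsEigenvector R r) (h : List A → ℝ) (n : ℕ) :
    ∑ u, R u * (P.transfer ℓ)^[n] h (List.ofFn u.1) = r ^ n * ∑ u, R u * h (List.ofFn u.1) := by
  induction n with
  | zero => simp
  | succ n ih => rw [Function.iterate_succ_apply', hr, ih, pow_succ', mul_assoc]

theorem IsEigenvector.eq_sum (hr : P.IsEigenvector R r) (hR1 : ∑ u, R u = 1) :
    r = ∑ u, R u * P.transfer ℓ (fun _ => 1) (List.ofFn u.1) := by
  rw [hr]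
  simp [hR1]

theorem IsEigenvector.one_lt (hr : P.IsEigenvector R r) (hℓ : 1 ≤ ℓ) (hR : ∀ u, 0 < R u)
    (hR1 : ∑ u, R u = 1) (hθ : θ.IsPrimitive)
    (hlong : ∀ N, ∃ v, θ.IsLegal v ∧ v.length = N) {a : A} {w : θ.words a}
    (hw : 2 ≤ w.1.length) (hPw : P.prob a w ≠ 0) : 1 < r := by
  have hlen : ∀ b, ∀ x : θ.words b, (1 : ℝ) ≤ x.1.length := fun b x => by
    exact_mod_cast List.length_pos_of_ne_nil (θ.ne_nil b x.1 x.2)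
  have hge : ∀ b, ∀ x : θ.words b, P.prob b x ≤ P.prob b x * x.1.length := fun b x =>
    le_mul_of_one_le_right (P.nonneg b x) (hlen b x)
  rw [hr.eq_sum hR1]
  refine hR1.symm.trans_lt ?_
  obtain ⟨t, ht, htl⟩ := hθ.exists_isLegal_cons hlong a (ℓ - 1)
  obtain rfl : (a :: t).length = ℓ := by rw [List.length_cons]; omega
  obtain ⟨u, hu⟩ := exists_legalWord ht
  refine Finset.sum_lt_sum (fun v _ => le_mul_of_one_le_right (hR v).le ?_) ⟨u, Finset.mem_univ _, ?_⟩
  · match hv : List.ofFn v.1, LegalWord.length_ofFn v with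
    | b :: s, _ =>
      rw [transfer_one, ← P.sum_eq_one b]
      exact Finset.sum_le_sum fun x _ => hge b x
  · refine lt_mul_of_one_lt_right (hR u) ?_
    rw [hu, transfer_one]
    conv_lhs => rw [← P.sum_eq_one a]
    refine Finset.sum_lt_sum (fun x _ => hge a x) ⟨w, Finset.mem_univ _, ?_⟩
    refine lt_mul_of_one_lt_right ((P.nonneg a w).lt_of_ne' hPw) ?_
    exact_mod_cast hw

theorem IsEigenvector.sum_nonpos (hr : P.IsEigenvector R r) (hr1 : 1 < r) {h : List A → ℝ} {C : ℝ}
    (hC : ∀ n, ∑ u, R u * (P.transfer ℓ)^[n] h (List.ofFn u.1) ≤ C) :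
    ∑ u, R u * h (List.ofFn u.1) ≤ 0 := by
  by_contra! hpos
  have h1 := (tendsto_pow_atTop_atTop_of_one_lt hr1).atTop_mul_const hpos
  obtain ⟨n, hn⟩ := (h1.eventually_gt_atTop C).exists
  exact absurd (hC n) (not_le.2 (by rwa [hr.iterate]))

end eigen

end Probabilities

end RandomSubstitution

namespace RandomSubstitution

variable {A : Type*} {θ : RandomSubstitution A}

/-! ### Bi-infinite sequences and uniform recurrence -/

theorem exists_subwordAt_of_infix {x : ℤ → A} {k : ℤ} {N : ℕ} {w : List A}
    (h : w <:+: subwordAt x k N) : ∃ j, subwordAt x j w.length = w := by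
  obtain ⟨s, t, h⟩ := h
  refine ⟨k + s.length, List.ext_getElem (by simp [subwordAt]) fun i h1 h2 => ?_⟩
  have h3 : s.length + i < (subwordAt x k N).length := by
    rw [← h]
    simp only [List.length_append]
    omega
  have h4 : (subwordAt x k N)[s.length + i] = w[i] := by
    simp only [← h, List.append_assoc]
    rw [List.getElem_append_right (by omega), List.getElem_append_left (by omega)]
    simp
  rw [← h4]
  simp [subwordAt, add_assoc]

/-- The bi-infinite sequence which continues the word `v`, placed at position `-c`, by a constant. -/
def extendWord (a : A) (v : List A) (c : ℕ) (i : ℤ) : A :=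
  v.getD (i + c).toNat a

theorem subwordAt_extendWord {a : A} {v : List A} {c ℓ : ℕ} {k : ℤ} (hk : -(c : ℤ) ≤ k)
    (hkℓ : k + ℓ + c ≤ v.length) :
    subwordAt (extendWord a v c) k ℓ = (v.drop (k + c).toNat).take ℓ := by
  refine List.ext_getElem ?_ fun i h1 h2 => ?_
  · simp only [subwordAt, List.length_ofFn, List.length_take, List.length_drop]
    omega
  · simp only [subwordAt, List.length_ofFn] at h1
    simp only [subwordAt, extendWord, List.getElem_ofFn, List.getElem_take, List.getElem_drop]
    rw [show (k + i + c).toNat = (k + c).toNat + i by omega,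
      List.getD_eq_getElem _ _ (by omega)]

theorem subwordAt_extendWord_infix {a : A} {v : List A} {c ℓ : ℕ} {k : ℤ} (hk : -(c : ℤ) ≤ k)
    (hkℓ : k + ℓ + c ≤ v.length) : subwordAt (extendWord a v c) k ℓ <:+: v := by
  rw [subwordAt_extendWord hk hkℓ]
  exact (List.take_prefix _ _).isInfix.trans (List.drop_suffix _ _).isInfix

theorem subwordAt_congr {x y : ℤ → A} {k : ℤ} {ℓ : ℕ}
    (h : ∀ i, k ≤ i → i < k + ℓ → x i = y i) : subwordAt x k ℓ = subwordAt y k ℓ := by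
  unfold subwordAt
  congr 1
  funext i
  exact h _ (by omega) (by omega)

/-- Every sequence of bi-infinite words over a finite alphabet has a cluster point. -/
theorem exists_forall_exists_eqOn [Finite A] (y : ℕ → ℤ → A) :
    ∃ x : ℤ → A, ∀ m : ℕ, ∃ n ≥ m, ∀ i : ℤ, -(m : ℤ) ≤ i → i ≤ m → x i = y n i := by
  let _ : TopologicalSpace A := ⊥
  have : DiscreteTopology A := ⟨rfl⟩
  obtain ⟨x, hx⟩ := exists_clusterPt_of_compactSpace (Filter.map y Filter.atTop)
  refine ⟨x, fun m => ?_⟩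
  have hU : (Set.Icc (-(m : ℤ)) m).pi (fun i => {x i}) ∈ nhds x :=
    set_pi_mem_nhds (Set.finite_Icc _ _) fun i _ => (isOpen_discrete _).mem_nhds rfl
  have h1 : ∃ᶠ n in Filter.atTop, y n ∈ (Set.Icc (-(m : ℤ)) m).pi (fun i => {x i}) :=
    (mapClusterPt_iff_frequently.1 hx) _ hU
  obtain ⟨n, hn, hy⟩ := Filter.frequently_atTop.1 h1 m
  exact ⟨n, hn, fun i h1 h2 => (hy i ⟨h1, h2⟩).symm⟩

theorem IsPrimitive.exists_isLegal_append (hθ : θ.IsPrimitive)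
    (hlong : ∀ N, ∃ v, θ.IsLegal v ∧ v.length = N) {w : List A} (hw : θ.IsLegal w) (N : ℕ) :
    ∃ s t, θ.IsLegal (s ++ w ++ t) ∧ N ≤ s.length ∧ N ≤ t.length := by
  obtain ⟨k, -, hk⟩ := hθ
  obtain ⟨n, -, a, hw⟩ := hw
  obtain ⟨v, hv, hvl⟩ := hlong (N + 1 + N)
  have h1 : (v.take N).length = N := by rw [List.length_take]; omega
  match hc : v.drop N with
  | [] => have := congrArg List.length hc; simp only [List.length_drop, List.length_nil] at this; omega
  | c :: v' =>
    have hv' : v'.length = N := by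
      have := congrArg List.length hc
      simp only [List.length_drop, List.length_cons] at this
      omega
    obtain ⟨x, hx, p, q, hpq⟩ := (hk a c).trans hw
    obtain ⟨s, hs⟩ := θ.exists_isPowRealisation (k + n) (v.take N)
    obtain ⟨t, ht⟩ := θ.exists_isPowRealisation (k + n) v'
    have hsl := hs.length_le
    have htl := ht.length_le
    rw [← List.take_append_drop N v, hc] at hv
    have := hv.of_isPowRealisation (hs.append (hx.append ht))
    refine ⟨s ++ p, q ++ t, ?_, by rw [List.length_append]; omega,
      by rw [List.length_append]; omega⟩
    simpa [← hpq] using this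

section subshift

variable [TopologicalSpace A] [DiscreteTopology A]

theorem exists_isLegal_of_nonempty (hne : θ.subshift.carrier.Nonempty) (N : ℕ) :
    ∃ v, θ.IsLegal v ∧ v.length = N := by
  obtain ⟨x, hx⟩ := hne
  exact ⟨subwordAt x 0 N, hx 0 N, length_subwordAt x 0 N⟩

theorem exists_mem_subshift_subwordAt_eq [Finite A] (hθ : θ.IsPrimitive)
    (hlong : ∀ N, ∃ v, θ.IsLegal v ∧ v.length = N) {w : List A} (hw : θ.IsLegal w) :
    ∃ x ∈ θ.subshift.carrier, subwordAt x 0 w.length = w := by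
  have ⟨v, hv, hvl⟩ := hlong 1
  obtain ⟨a, rfl⟩ := List.length_eq_one_iff.1 hvl
  choose s t hst hs ht using hθ.exists_isLegal_append hlong hw
  obtain ⟨x, hx⟩ := exists_forall_exists_eqOn
    fun n => extendWord a (s n ++ w ++ t n) (s n).length
  refine ⟨x, fun k ℓ => ?_, ?_⟩
  · obtain ⟨n, hn, hxn⟩ := hx (k.natAbs + ℓ)
    rw [subwordAt_congr fun i h1 h2 => hxn i (by omega) (by omega)]
    have := hs n
    have := ht n
    refine (hst n).of_infix (subwordAt_extendWord_infix (by omega) ?_)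
    simp only [List.length_append]
    omega
  · obtain ⟨n, hn, hxn⟩ := hx w.length
    rw [subwordAt_congr fun i h1 h2 => hxn i (by omega) (by omega),
      subwordAt_extendWord (by omega) (by simp only [List.length_append]; omega)]
    simp

/-- In a minimal subshift, every legal word occurs in every long legal word. -/
theorem exists_forall_infix_of_isMinimal [Finite A] (hθ : θ.IsPrimitive)
    (hlong : ∀ N, ∃ v, θ.IsLegal v ∧ v.length = N) (hmin : AddAction.IsMinimal ℤ θ.Space)
    {w : List A} (hw : θ.IsLegal w) :
    ∃ N, ∀ v, θ.IsLegal v → N ≤ v.length → w <:+: v := by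
  by_contra! hc
  choose v hv hvl hvw using hc
  have ⟨v₁, hv₁, hvl₁⟩ := hlong 1
  obtain ⟨a, rfl⟩ := List.length_eq_one_iff.1 hvl₁
  obtain ⟨x, hx⟩ := exists_forall_exists_eqOn fun n => extendWord a (v (n + n)) n
  have hinf : ∀ k ℓ, ∃ n, subwordAt x k ℓ <:+: v n := by
    intro k ℓ
    obtain ⟨n, hn, hxn⟩ := hx (k.natAbs + ℓ)
    rw [subwordAt_congr fun i h1 h2 => hxn i (by omega) (by omega)]
    have := hvl (n + n)
    exact ⟨n + n, subwordAt_extendWord_infix (by omega) (by omega)⟩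
  have hxX : x ∈ θ.subshift.carrier := fun k ℓ => by
    obtain ⟨n, hn⟩ := hinf k ℓ
    exact (hv n).of_infix hn
  obtain ⟨z, hz, hzw⟩ := exists_mem_subshift_subwordAt_eq hθ hlong hw
  let U : Set θ.Space := {p | ∀ i : Fin w.length, p.1 i = z i}
  have hU : IsOpen U := by
    simp only [U, Set.ofPred_forall]
    refine isOpen_iInter_of_finite fun i => ?_
    have hc : Continuous fun p : θ.Space => p.1 i :=
      (continuous_apply (i : ℤ)).comp continuous_subtype_val
    exact (isOpen_discrete {z i}).preimage hc
  obtain ⟨p, hp, g, rfl⟩ := (hmin.dense_orbit ⟨x, hxX⟩).inter_open_nonempty U hU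
    ⟨⟨z, hz⟩, fun i => rfl⟩
  have h1 : subwordAt x g w.length = w := by
    rw [← hzw, subwordAt, length_subwordAt]
    unfold subwordAt
    congr 1
    funext i
    rw [zero_add]
    exact hp i
  obtain ⟨n, hn⟩ := hinf g w.length
  rw [h1] at hn
  exact hvw n hn

/-- A subshift all of whose legal words occur in all long legal words is minimal. -/
theorem isMinimal_of_forall_exists_infix
    (h : ∀ w, θ.IsLegal w → ∃ N, ∀ v, θ.IsLegal v → N ≤ v.length → w <:+: v) :
    AddAction.IsMinimal ℤ θ.Space := by
  refine ⟨fun x => dense_iff_inter_open.2 ?_⟩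
  rintro _ ⟨V, hV, rfl⟩ ⟨y, hy⟩
  obtain ⟨I, u, hu, hIV⟩ := isOpen_pi_iff.1 hV y.1 hy
  set m := I.sup Int.natAbs
  have hm : ∀ i ∈ I, i.natAbs ≤ m := fun i hi => Finset.le_sup hi
  obtain ⟨N, hN⟩ := h _ (y.2 (-m) (2 * m + 1))
  obtain ⟨j, hj⟩ := exists_subwordAt_of_infix
    (hN _ (x.2 0 N) (length_subwordAt x.1 0 N).ge)
  rw [length_subwordAt] at hj
  refine ⟨(j + m) +ᵥ x, hIV fun i hi => ?_, j + m, rfl⟩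
  have hi' := hm i hi
  have h1 := congrFun (List.ofFn_injective hj) ⟨(i + m).toNat, by omega⟩
  simp only at h1
  rw [show j + ((i + m).toNat : ℤ) = j + m + i by omega,
    show -(m : ℤ) + ((i + m).toNat : ℤ) = i by omega] at h1
  have h2 : ((j + m) +ᵥ x : θ.Space).1 i = y.1 i := h1
  rw [h2]
  exact (hu i hi).2

end subshift

end RandomSubstitution

namespace RandomSubstitution

variable {A : Type*} {θ : RandomSubstitution A}

open WordSubstitution

/-! ### Minimality implies that the frequency vectors are constant -/

section occ

variable [DecidableEq A]

theorem blockSum_le_occ (W v : List A) {m : ℕ} (hm : m ≤ v.length) :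
    blockSum W.length (fun x => if x = W then 1 else 0) v m ≤ occ W v := by
  rw [occ_eq_sum, blockSum]
  push_cast
  refine (Finset.sum_le_sum fun q _ => ?_).trans (Finset.sum_le_sum_of_subset_of_nonneg
    (Finset.range_mono hm) fun q _ _ => by split_ifs <;> norm_num)
  split_ifs with h1 h2
  · exact le_rfl
  · refine absurd ?_ h2
    conv_lhs => rw [← h1]
    exact List.take_prefix _ _
  · norm_num
  · exact le_rfl

theorem occ_le_blockSum_add (W v : List A) {m : ℕ} (hm : m ≤ v.length) :
    (occ W v : ℝ) ≤ blockSum W.length (fun x => if x = W then 1 else 0) v m + (v.length - m) := by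
  obtain ⟨j, hj⟩ := Nat.exists_eq_add_of_le hm
  rw [occ_eq_sum, blockSum, hj, Finset.sum_range_add]
  push_cast
  refine add_le_add (Finset.sum_le_sum fun q _ => ?_) ?_
  · split_ifs with h1 h2
    · exact le_rfl
    · exact absurd (List.prefix_iff_eq_take.1 h1).symm h2
    · norm_num
    · exact le_rfl
  · refine (Finset.sum_le_sum (g := fun _ => (1 : ℝ)) fun q _ => ?_).trans (by simp)
    split_ifs <;> norm_num

end occ

theorem blockSum_sub_const (ℓ : ℕ) (h : List A → ℝ) (c : ℝ) (v : List A) (m : ℕ) :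
    blockSum ℓ (fun x => h x - c) v m = blockSum ℓ h v m - m * c := by
  simp [blockSum]

theorem blockSum_const_sub (ℓ : ℕ) (h : List A → ℝ) (c : ℝ) (v : List A) (m : ℕ) :
    blockSum ℓ (fun x => c - h x) v m = m * c - blockSum ℓ h v m := by
  simp [blockSum]

theorem blockSum_take {ℓ m : ℕ} (h : List A → ℝ) {v : List A} (hm : m + ℓ ≤ v.length + 1) :
    blockSum ℓ h v m = blockSum ℓ h (v.take (m + ℓ - 1)) m := by
  conv_lhs => rw [← List.take_append_drop (m + ℓ - 1) v]
  exact blockSum_append_of_le h _ (by rw [List.length_take]; omega)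

namespace Probabilities

variable [Fintype A] {P : θ.Probabilities} {ℓ : ℕ} {R : θ.LegalWord ℓ → ℝ} {r : ℝ}

theorem IsEigenvector.sum_nonpos_of_blockSum_le (hr : P.IsEigenvector R r) (hr1 : 1 < r)
    (hℓ : 1 ≤ ℓ) (hR : ∀ u, 0 < R u) (hR1 : ∑ u, R u = 1) {h : List A → ℝ} {C : ℝ}
    (hC : ∀ v m, θ.IsLegal v → m + ℓ = v.length + 1 → blockSum ℓ h v m ≤ C) :
    ∑ u, R u * h (List.ofFn u.1) ≤ 0 := by
  refine hr.sum_nonpos hr1 (C := C) fun n => ?_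
  have hn : ∀ v m, θ.IsLegal v → m + ℓ ≤ v.length + 1 →
      blockSum ℓ ((P.transfer ℓ)^[n] h) v m ≤ C := by
    induction n with
    | zero =>
      intro v m hv hm
      rw [Function.iterate_zero_apply, blockSum_take h hm]
      exact hC _ m (hv.of_infix (List.take_prefix _ _).isInfix) (by rw [List.length_take]; omega)
    | succ n ih =>
      rw [Function.iterate_succ_apply']
      exact P.blockSum_transfer_le hℓ ih
  calc ∑ u, R u * (P.transfer ℓ)^[n] h (List.ofFn u.1) ≤ ∑ u, R u * C := by
        refine Finset.sum_le_sum fun u _ => mul_le_mul_of_nonneg_left ?_ (hR u).le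
        have hl := LegalWord.length_ofFn u
        have := hn (List.ofFn u.1) 1 u.2 (by omega)
        simpa [blockSum, List.take_of_length_le hl.le] using this
    _ = C := by rw [← Finset.sum_mul, hR1, one_mul]

theorem IsEigenvector.eq_frequency [DecidableEq A] (hr : P.IsEigenvector R r) (hr1 : 1 < r)
    (hℓ : 1 ≤ ℓ) (hR : ∀ u, 0 < R u) (hR1 : ∑ u, R u = 1) (w : θ.LegalWord ℓ) {f : ℝ}
    (hf : ∀ ε > 0, ∃ C : ℝ, ∀ v, θ.IsLegal v →
      (f - ε) * v.length - C ≤ occ (List.ofFn w.1) v ∧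
        (occ (List.ofFn w.1) v : ℝ) ≤ (f + ε) * v.length + C) : R w = f := by
  set W := List.ofFn w.1
  have hW : W.length = ℓ := LegalWord.length_ofFn w
  have hind : ∑ u, R u * (if List.ofFn u.1 = W then 1 else 0) = R w := by
    rw [Finset.sum_eq_single w]
    · simp [W]
    · intro u _ hu
      rw [if_neg fun h => hu (LegalWord.ofFn_injective h), mul_zero]
    · simp
  have hlen : ∀ {v : List A} {m : ℕ}, m + ℓ = v.length + 1 → (v.length : ℝ) = m + ℓ - 1 := by
    intro v m h
    have : ((m + ℓ : ℕ) : ℝ) = (v.length + 1 : ℕ) := by rw [h]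
    push_cast at this
    linarith
  apply le_antisymm
  · refine le_of_forall_pos_le_add fun ε hε => ?_
    obtain ⟨C, hC⟩ := hf ε hε
    have := hr.sum_nonpos_of_blockSum_le hr1 hℓ hR hR1 (C := (f + ε) * (ℓ - 1) + C)
      (h := fun x => (if x = W then 1 else 0) - (f + ε)) ?_
    · simp only [mul_sub, Finset.sum_sub_distrib, hind, ← Finset.sum_mul, hR1] at this
      linarith
    · intro v m hv hm
      have h1 := blockSum_le_occ W v (m := m) (by omega)
      have h2 := (hC v hv).2
      rw [blockSum_sub_const, ← hW]
      rw [hlen hm, ← hW] at h2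
      linarith
  · refine le_of_forall_pos_le_add fun ε hε => ?_
    obtain ⟨C, hC⟩ := hf ε hε
    have := hr.sum_nonpos_of_blockSum_le hr1 hℓ hR hR1
      (C := C + (ℓ - 1) - (f - ε) * (ℓ - 1))
      (h := fun x => (f - ε) - (if x = W then 1 else 0)) ?_
    · simp only [mul_sub, Finset.sum_sub_distrib, hind, ← Finset.sum_mul, hR1] at this
      linarith
    · intro v m hv hm
      have h1 := occ_le_blockSum_add W v (m := m) (by omega)
      have h2 := (hC v hv).1
      rw [blockSum_const_sub, ← hW]
      rw [hlen hm, ← hW] at h1 h2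
      linarith

theorem rightVector_eq_of_isMinimal [DecidableEq A] [TopologicalSpace A] [DiscreteTopology A]
    (hθ : θ.IsPrimitive) (hne : θ.subshift.carrier.Nonempty)
    (hmin : AddAction.IsMinimal ℤ θ.Space) (ℓ : ℕ) [NeZero ℓ] {Q Q' : θ.Probabilities}
    (hQ : Q.NonDegenerate) (hQ' : Q'.NonDegenerate) : Q.rightVector ℓ = Q'.rightVector ℓ := by
  have hlong := exists_isLegal_of_nonempty hne
  obtain ⟨n, τ, hτ, hτθ⟩ := hθ.exists_isPositive hlong
  have hgen : ∀ w, θ.IsLegal w → Generates τ w := by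
    intro w hw
    obtain ⟨N, hN⟩ := exists_forall_infix_of_isMinimal hθ hlong hmin hw
    obtain ⟨v, -, hvl⟩ := hlong 1
    obtain ⟨c, rfl⟩ := List.length_eq_one_iff.1 hvl
    have hc : Generates τ (iter τ N c) := ⟨N, c, List.infix_refl _⟩
    exact hc.of_infix (hN _ (hθ.isLegal_of_generates hτθ hc) (hτ.lt_length_iter N c).le)
  obtain ⟨K, hK⟩ := hτ.exists_linear_recurrence
  obtain ⟨a, x, hx, hx2⟩ := exists_two_le_length hlong
  funext w
  obtain ⟨f, hf⟩ := exists_frequency θ.IsLegal (fun u v huv hv => hv.of_infix huv) hlong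
    (fun u v hu hv => hK u v (hgen u hu) (hgen v hv)) (List.ofFn w.1)
  have key : ∀ Q : θ.Probabilities, Q.NonDegenerate → Q.rightVector ℓ w = f := by
    intro Q hQ
    have hspec := rightVector_spec (ℓ := ℓ) hQ hθ hlong
    obtain ⟨r, hr⟩ := isEigenvector_of_isPerronFrobeniusVector hspec
    have hℓ : 1 ≤ ℓ := NeZero.one_le
    exact hr.eq_frequency (hr.one_lt hℓ hspec.1 hspec.2.1 hθ hlong (w := ⟨x, hx⟩) hx2 (hQ _ _))
      hℓ hspec.1 hspec.2.1 w hf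
  rw [key Q hQ, key Q' hQ']

end Probabilities

end RandomSubstitution

namespace WordSubstitution

theorem iter_iter {A : Type*} (τ : A → List A) (p n : ℕ) (a : A) :
    iter (iter τ p) n a = iter τ (p * n) a := by
  induction n with
  | zero => rfl
  | succ n ih => rw [iter, ih, mul_add, mul_one, iter_add]

theorem flatMap_iter_succ {A : Type*} (τ : A → List A) (n : ℕ) (u : List A) :
    u.flatMap (iter τ (n + 1)) = (u.flatMap (iter τ n)).flatMap τ := by
  rw [List.flatMap_assoc]
  rfl

theorem length_le_length_flatMap_iter {A : Type*} {τ : A → List A} (hτ : ∀ a, τ a ≠ []) (n : ℕ)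
    (u : List A) : u.length ≤ (u.flatMap (iter τ n)).length := by
  have h1 : ∀ u : List A, u.length ≤ (u.flatMap τ).length := by
    intro u
    induction u with
    | nil => simp
    | cons a u ih =>
      have := List.length_pos_of_ne_nil (hτ a)
      simp only [List.flatMap_cons, List.length_append, List.length_cons]
      omega
  induction n with
  | zero => rw [flatMap_iter_zero]
  | succ n ih => exact ih.trans (flatMap_iter_succ τ n u ▸ h1 _)

/-- A substitution some power of which has a positive incidence matrix, and which lengthens some
word, has a positive power; all iterates of the substitution are generated by this power. -/
theorem exists_isPositive_iter {A : Type*} {σ : A → List A} (hσ : ∀ a, σ a ≠ []) {k : ℕ}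
    (hk : ∀ a b, a ∈ iter σ k b) {a₀ : A} (ha₀ : 2 ≤ (σ a₀).length) :
    IsPositive (iter σ (k + 1)) ∧ ∀ m c, Generates (iter σ (k + 1)) (iter σ m c) := by
  have hmem : ∀ j a b, a ∈ iter σ (k + j) b := by
    intro j a b
    rw [add_comm, iter_add]
    obtain ⟨c, hc⟩ := List.exists_mem_of_ne_nil (iter σ j b) fun h => by
      have := length_le_length_flatMap_iter hσ j [b]
      simp [h] at this
    exact List.mem_flatMap.2 ⟨c, hc, hk a c⟩
  refine ⟨⟨fun a b => hmem 1 b a, fun a => ?_⟩, fun m c => ?_⟩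
  · exact ha₀.trans (infix_flatMap_of_mem (hk a₀ a)).length_le
  · refine ⟨m + 1, c, ?_⟩
    rw [iter_iter, show (k + 1) * (m + 1) = k + (k * m + 1) + m by ring, iter_add]
    exact infix_flatMap_of_mem (hmem _ c c)

end WordSubstitution

namespace RandomSubstitution

variable {A : Type*} {θ : RandomSubstitution A}

open WordSubstitution

/-! ### Constant frequency vectors imply minimality -/

namespace Probabilities

/-- The degenerate probabilities which choose the image `σ a` of every letter `a`. -/
def dirac [DecidableEq A] (σ : (a : A) → θ.words a) : θ.Probabilities where
  prob a w := if w = σ a then 1 else 0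
  nonneg a w := by split_ifs <;> norm_num
  sum_eq_one a := by simp

/-- A convex combination of two families of probability vectors. -/
def mix (P Q : θ.Probabilities) (t : ℝ) (ht : 0 ≤ t) (ht' : t ≤ 1) : θ.Probabilities where
  prob a w := t * P.prob a w + (1 - t) * Q.prob a w
  nonneg a w := add_nonneg (mul_nonneg ht (P.nonneg a w))
    (mul_nonneg (sub_nonneg.2 ht') (Q.nonneg a w))
  sum_eq_one a := by
    rw [Finset.sum_add_distrib, ← Finset.mul_sum, ← Finset.mul_sum, P.sum_eq_one, Q.sum_eq_one]
    ring

theorem NonDegenerate.mix {P : θ.Probabilities} (hP : P.NonDegenerate) (Q : θ.Probabilities)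
    {t : ℝ} (ht : 0 < t) (ht' : t ≤ 1) : (P.mix Q t ht.le ht').NonDegenerate := fun a w =>
  (add_pos_of_pos_of_nonneg (mul_pos ht ((P.nonneg a w).lt_of_ne' (hP a w)))
    (mul_nonneg (sub_nonneg.2 ht') (Q.nonneg a w))).ne'

section limit

open Filter Topology

variable {P : ℕ → θ.Probabilities} {Q : θ.Probabilities}

theorem tendsto_expect (h : ∀ a w, Tendsto (fun n => (P n).prob a w) atTop (𝓝 (Q.prob a w)))
    (u : List A) (F : List A → ℝ) :
    Tendsto (fun n => (P n).expect u F) atTop (𝓝 (Q.expect u F)) := by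
  induction u generalizing F with
  | nil => exact tendsto_const_nhds
  | cons a u ih => exact tendsto_finsetSum _ fun w _ => (h a w).mul (ih _)

theorem tendsto_transfer (h : ∀ a w, Tendsto (fun n => (P n).prob a w) atTop (𝓝 (Q.prob a w)))
    (ℓ : ℕ) (F : List A → ℝ) (u : List A) :
    Tendsto (fun n => (P n).transfer ℓ F u) atTop (𝓝 (Q.transfer ℓ F u)) := by
  cases u with
  | nil => exact tendsto_const_nhds
  | cons a u => exact tendsto_finsetSum _ fun w _ => (h a w).mul (tendsto_expect h _ _)

/-- A common eigenvector for all non-degenerate probabilities is also an eigenvector for the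
degenerate ones. -/
theorem isEigenvector_of_forall_nonDegenerate [Fintype A] {P₀ : θ.Probabilities}
    (hP₀ : P₀.NonDegenerate) {ℓ : ℕ} {R : θ.LegalWord ℓ → ℝ} (hR1 : ∑ u, R u = 1)
    (hR : ∀ P : θ.Probabilities, P.NonDegenerate → ∃ r, P.IsEigenvector R r)
    (Q : θ.Probabilities) : ∃ r, Q.IsEigenvector R r := by
  have ht : ∀ n : ℕ, (0 : ℝ) < 1 / ((n : ℝ) + 1) := fun n => Nat.one_div_pos_of_nat
  have ht' : ∀ n : ℕ, 1 / ((n : ℝ) + 1) ≤ 1 := fun n => by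
    rw [div_le_one (by positivity)]
    linarith [Nat.cast_nonneg (α := ℝ) n]
  set P : ℕ → θ.Probabilities := fun n => P₀.mix Q _ (ht n).le (ht' n)
  have hlim : ∀ a w, Tendsto (fun n => (P n).prob a w) atTop (𝓝 (Q.prob a w)) := by
    intro a w
    have h0 := tendsto_one_div_add_atTop_nhds_zero_nat (𝕜 := ℝ)
    have := (h0.mul_const (P₀.prob a w)).add ((h0.const_sub 1).mul_const (Q.prob a w))
    simpa [P, mix] using this
  have hsum : ∀ h : List A → ℝ, Tendsto (fun n => ∑ u, R u * (P n).transfer ℓ h (List.ofFn u.1))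
      atTop (𝓝 (∑ u, R u * Q.transfer ℓ h (List.ofFn u.1))) := fun h =>
    tendsto_finsetSum _ fun u _ => (tendsto_transfer hlim ℓ h _).const_mul _
  refine ⟨∑ u, R u * Q.transfer ℓ (fun _ => 1) (List.ofFn u.1), fun h =>
    tendsto_nhds_unique (hsum h) ?_⟩
  refine ((hsum fun _ => 1).mul_const (∑ u, R u * h (List.ofFn u.1))).congr fun n => ?_
  obtain ⟨r, hr⟩ := hR (P n) (hP₀.mix Q (ht n) (ht' n))
  rw [← hr.eq_sum hR1, hr]

end limit

section dirac

variable [DecidableEq A] (σ : (a : A) → θ.words a)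

theorem expect_dirac (u : List A) (F : List A → ℝ) :
    (dirac σ).expect u F = F (u.flatMap fun a => (σ a).1) := by
  induction u generalizing F with
  | nil => rfl
  | cons a u ih =>
    simp only [expect, ih]
    simp [dirac]

theorem transfer_dirac (ℓ : ℕ) (h : List A → ℝ) (a : A) (u : List A) :
    (dirac σ).transfer ℓ h (a :: u) =
      blockSum ℓ h ((σ a).1 ++ u.flatMap fun a => (σ a).1) (σ a).1.length := by
  simp only [transfer, expect_dirac]
  simp [dirac]

theorem blockSum_iterate_transfer_dirac {ℓ : ℕ} (hℓ : 1 ≤ ℓ) (h : List A → ℝ) (n : ℕ)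
    {s t : List A} (ht : ℓ ≤ t.length + 1) :
    blockSum ℓ (((dirac σ).transfer ℓ)^[n] h) (s ++ t) s.length =
      blockSum ℓ h (s.flatMap (iter (fun a => (σ a).1) n) ++ t.flatMap (iter (fun a => (σ a).1) n))
        (s.flatMap (iter (fun a => (σ a).1) n)).length := by
  induction n generalizing h with
  | zero => simp [flatMap_iter_zero]
  | succ n ih =>
    have hl := length_le_length_flatMap_iter (fun a => θ.ne_nil a _ (σ a).2) n t
    rw [Function.iterate_succ_apply, ih,
      blockSum_transfer _ hℓ h (by rw [List.length_append]; omega),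
      List.take_left, List.drop_left, expect_dirac, expect_dirac]
    simp only [List.flatMap_assoc]
    rfl

theorem IsEigenvector.generates [Fintype A] {ℓ : ℕ} {R : θ.LegalWord ℓ → ℝ} {r : ℝ}
    (hr : (dirac σ).IsEigenvector R r) (hr1 : 1 < r) (hℓ : 1 ≤ ℓ) (hR : ∀ u, 0 < R u)
    (hR1 : ∑ u, R u = 1) {τ : A → List A}
    (hτ : ∀ n c, Generates τ (iter (fun a => (σ a).1) n c)) (w : θ.LegalWord ℓ) :
    Generates τ (List.ofFn w.1) := by
  classical
  set h : List A → ℝ := fun x => if Generates τ x then 0 else 1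
  have h0 : ∀ x, 0 ≤ h x := fun x => by simp only [h]; split_ifs <;> norm_num
  have h1 : ∀ x, h x ≤ 1 := fun x => by simp only [h]; split_ifs <;> norm_num
  have hbd : ∀ x y : List A, Generates τ x → blockSum ℓ h (x ++ y) x.length ≤ ℓ := by
    intro x y hx
    calc blockSum ℓ h (x ++ y) x.length
        ≤ ∑ q ∈ Finset.range x.length, if x.length + 1 - ℓ ≤ q then (1 : ℝ) else 0 := by
          refine Finset.sum_le_sum fun q _ => ?_
          split_ifs with hq
          · exact h1 _
          · refine (if_pos (hx.of_infix ?_)).le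
            rw [List.drop_append_of_le_length (by omega), List.take_append_of_le_length
              (by rw [List.length_drop]; omega)]
            exact (List.take_prefix _ _).isInfix.trans (List.drop_suffix _ _).isInfix
      _ ≤ ((Finset.Ico (x.length + 1 - ℓ) x.length).card : ℝ) := by
          rw [Finset.sum_boole]
          exact_mod_cast Finset.card_le_card fun q hq => by
            rw [Finset.mem_filter, Finset.mem_range] at hq
            exact Finset.mem_Ico.2 ⟨hq.2, hq.1⟩
      _ ≤ ℓ := by
          rw [Nat.card_Ico]
          exact_mod_cast (by omega : x.length - (x.length + 1 - ℓ) ≤ ℓ)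
  have hn : ∀ n, ∑ u, R u * ((dirac σ).transfer ℓ)^[n] h (List.ofFn u.1) ≤ ℓ := by
    intro n
    calc ∑ u, R u * ((dirac σ).transfer ℓ)^[n] h (List.ofFn u.1) ≤ ∑ u, R u * (ℓ : ℝ) := by
          refine Finset.sum_le_sum fun u _ => mul_le_mul_of_nonneg_left ?_ (hR u).le
          match hu : List.ofFn u.1, LegalWord.length_ofFn u with
          | [], hl => simp only [List.length_nil] at hl; omega
          | a :: t, hl =>
            have h2 := blockSum_iterate_transfer_dirac σ hℓ h n (s := [a]) (t := t)
              (by simp only [List.length_cons] at hl; omega)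
            have h3 : blockSum ℓ (((dirac σ).transfer ℓ)^[n] h) ([a] ++ t) [a].length =
                ((dirac σ).transfer ℓ)^[n] h (a :: t) := by
              simp [blockSum, List.take_of_length_le hl.le]
            rw [← h3, h2, List.flatMap_singleton]
            exact hbd _ _ (hτ n a)
      _ = ℓ := by rw [← Finset.sum_mul, hR1, one_mul]
  have hle := hr.sum_nonpos hr1 hn
  by_contra hw
  have : R w * h (List.ofFn w.1) ≤ ∑ u, R u * h (List.ofFn u.1) :=
    Finset.single_le_sum (f := fun u => R u * h (List.ofFn u.1))
      (fun u _ => mul_nonneg (hR u).le (h0 _)) (Finset.mem_univ w)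
  have h2 : h (List.ofFn w.1) = 1 := if_neg hw
  rw [h2, mul_one] at this
  linarith [hR w]

/-- If some vector on letters is an eigenvector for all probabilities, then a longest image of a
letter contains all letters of all other images. -/
theorem mem_of_forall_isEigenvector [Fintype A] {R : θ.LegalWord 1 → ℝ}
    (hR : ∀ u, 0 < R u) (hR1 : ∑ u, R u = 1)
    (hRQ : ∀ Q : θ.Probabilities, ∃ r, Q.IsEigenvector R r)
    (hletter : ∀ a, θ.IsLegal [a]) (hσ : ∀ a, ∀ w ∈ θ.words a, w.length ≤ (σ a).1.length)
    {a b : A} {w : List A} (hw : w ∈ θ.words b) (ha : a ∈ w) : a ∈ (σ b).1 := by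
  by_contra hab
  set σ' : (a : A) → θ.words a := Function.update σ b ⟨w, hw⟩ with hσ'
  obtain ⟨r, hr⟩ := hRQ (dirac σ)
  obtain ⟨r', hr'⟩ := hRQ (dirac σ')
  have hofFn : ∀ u : θ.LegalWord 1, List.ofFn u.1 = [u.1 0] := fun u => by simp
  have htr : ∀ (s : (a : A) → θ.words a) (h : List A → ℝ) (c : A),
      (dirac s).transfer 1 h [c] = blockSum 1 h (s c).1 (s c).1.length := fun s h c => by
    rw [transfer_dirac, List.flatMap_nil, List.append_nil]
  set h : List A → ℝ := fun x => if x = [a] then 1 else 0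
  have h0 : ∀ x, 0 ≤ h x := fun x => by simp only [h]; split_ifs <;> norm_num
  have hle : r' ≤ r := by
    rw [hr.eq_sum hR1, hr'.eq_sum hR1]
    refine Finset.sum_le_sum fun u _ => mul_le_mul_of_nonneg_left ?_ (hR u).le
    rw [hofFn, htr, htr]
    simp only [blockSum, Finset.sum_const, Finset.card_range, nsmul_eq_mul, mul_one]
    exact_mod_cast hσ _ _ (σ' (u.1 0)).2
  have hb0 : blockSum 1 h (σ b).1 (σ b).1.length = 0 := by
    refine Finset.sum_eq_zero fun q _ => if_neg fun hq => hab ?_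
    exact List.mem_of_mem_drop (List.mem_of_mem_take (hq ▸ List.mem_singleton_self a))
  have hb1 : 0 < blockSum 1 h (σ' b).1 (σ' b).1.length := by
    rw [hσ', Function.update_self]
    obtain ⟨x, y, rfl⟩ := List.append_of_mem ha
    refine Finset.sum_pos' (fun _ _ => h0 _) ⟨x.length, by simp, ?_⟩
    simp [h]
  have hlt : r * ∑ u, R u * h (List.ofFn u.1) < r' * ∑ u, R u * h (List.ofFn u.1) := by
    rw [← hr h, ← hr' h]
    obtain ⟨u, hu⟩ := exists_legalWord (hletter b)
    have hub : u.1 0 = b := by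
      have := (hofFn u).symm.trans hu
      simpa using this
    refine Finset.sum_lt_sum (fun v _ => mul_le_mul_of_nonneg_left ?_ (hR v).le)
      ⟨u, Finset.mem_univ _, mul_lt_mul_of_pos_left ?_ (hR u)⟩
    · rw [hofFn, htr, htr]
      by_cases hv : v.1 0 = b
      · rw [hv, hb0]
        exact hb1.le
      · rw [hσ', Function.update_of_ne hv]
    · rw [hofFn, htr, htr, hub, hb0]
      exact hb1
  have hnn : 0 ≤ ∑ u, R u * h (List.ofFn u.1) :=
    Finset.sum_nonneg fun u _ => mul_nonneg (hR u).le (h0 _)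
  exact absurd (mul_le_mul_of_nonneg_right hle hnn) (not_le.2 hlt)

end dirac

theorem _root_.RandomSubstitution.IsRealisation.exists_mem {u v : List A}
    (h : θ.IsRealisation u v) {a : A} (ha : a ∈ v) : ∃ c ∈ u, ∃ w ∈ θ.words c, a ∈ w := by
  induction h with
  | nil => simp at ha
  | cons hw _ ih =>
    rcases List.mem_append.1 ha with ha | ha
    · exact ⟨_, List.mem_cons_self, _, hw, ha⟩
    · obtain ⟨c, hc, h⟩ := ih ha
      exact ⟨c, List.mem_cons_of_mem _ hc, h⟩

theorem _root_.RandomSubstitution.IsPowRealisation.mem_iter {σ : A → List A}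
    (hσ : ∀ a b, ∀ w ∈ θ.words b, a ∈ w → a ∈ σ b) {k : ℕ} {b : A} {x : List A}
    (hx : θ.IsPowRealisation k [b] x) {a : A} (ha : a ∈ x) : a ∈ iter σ k b := by
  induction k generalizing x a with
  | zero =>
    obtain rfl : x = [b] := hx
    exact ha
  | succ k ih =>
    obtain ⟨y, hy, hyx⟩ := hx
    obtain ⟨c, hc, w, hw, haw⟩ := hyx.exists_mem ha
    exact List.mem_flatMap.2 ⟨c, ih hy hc, hσ a c w hw haw⟩

theorem isMinimal_of_rightVector_eq [Fintype A] [DecidableEq A] [TopologicalSpace A]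
    [DiscreteTopology A] (hθ : θ.IsPrimitive) (hne : θ.subshift.carrier.Nonempty)
    {P : θ.Probabilities} (hP : P.NonDegenerate)
    (hconst : ∀ (ℓ : ℕ) [NeZero ℓ] (Q : θ.Probabilities), Q.NonDegenerate →
      Q.rightVector ℓ = P.rightVector ℓ) : AddAction.IsMinimal ℤ θ.Space := by
  have hlong := exists_isLegal_of_nonempty hne
  have hspec : ∀ (ℓ : ℕ) [NeZero ℓ], (P.induced ℓ).matrix.IsPerronFrobeniusVector
      (P.rightVector ℓ) := fun ℓ _ => rightVector_spec hP hθ hlong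
  have heig : ∀ (ℓ : ℕ) [NeZero ℓ] (Q : θ.Probabilities),
      ∃ r, Q.IsEigenvector (P.rightVector ℓ) r := fun ℓ _ Q =>
    isEigenvector_of_forall_nonDegenerate hP (hspec ℓ).2.1 (fun Q' hQ' => by
      rw [← hconst ℓ Q' hQ']
      exact isEigenvector_of_isPerronFrobeniusVector (rightVector_spec hQ' hθ hlong)) Q
  have hmax : ∀ a, ∃ w : θ.words a, ∀ x ∈ θ.words a, x.length ≤ w.1.length := fun a => by
    obtain ⟨w, hw, h⟩ := (θ.words a).exists_max_image List.length (θ.words_nonempty a)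
    exact ⟨⟨w, hw⟩, h⟩
  choose σ hσ using hmax
  have hmem : ∀ a b, ∀ w ∈ θ.words b, a ∈ w → a ∈ (σ b).1 := fun a b w hw ha =>
    mem_of_forall_isEigenvector σ (hspec 1).1 (hspec 1).2.1 (heig 1) hθ.isLegal_singleton hσ hw ha
  obtain ⟨k, -, hk⟩ := id hθ
  have hkσ : ∀ a b, a ∈ iter (fun a => (σ a).1) k b := fun a b => by
    obtain ⟨x, hx, hax⟩ := hk a b
    exact hx.mem_iter hmem (hax.subset (List.mem_singleton_self a))
  obtain ⟨a₀, x, hx, hx2⟩ := exists_two_le_length hlong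
  have ha₀ : 2 ≤ (σ a₀).1.length := hx2.trans (hσ a₀ x hx)
  obtain ⟨hτ, hτσ⟩ := exists_isPositive_iter (fun a => θ.ne_nil a _ (σ a).2) hkσ ha₀
  have hgen : ∀ w, θ.IsLegal w → Generates (iter (fun a => (σ a).1) (k + 1)) w := by
    intro w hw
    rcases eq_or_ne w [] with rfl | hw0
    · exact ⟨0, a₀, List.nil_infix⟩
    have hl : 1 ≤ w.length := List.length_pos_of_ne_nil hw0
    have : NeZero w.length := ⟨by omega⟩
    obtain ⟨v, hv⟩ := exists_legalWord hw
    obtain ⟨r, hr⟩ := heig w.length (dirac σ)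
    rw [← hv]
    exact hr.generates σ (hr.one_lt hl (hspec _).1 (hspec _).2.1 hθ hlong ha₀ (by simp [dirac]))
      hl (hspec _).1 (hspec _).2.1 hτσ v
  refine isMinimal_of_forall_exists_infix fun w hw => ?_
  obtain ⟨N, hN⟩ := hτ.exists_forall_infix (hgen w hw)
  exact ⟨N, fun v hv => hN v (hgen v hv)⟩

end Probabilities

end RandomSubstitution

theorem mainTheorem9 {A : Type*} [Fintype A] [DecidableEq A] [TopologicalSpace A]
    [DiscreteTopology A] [MeasurableSpace A] [DiscreteMeasurableSpace A]
    (θ : RandomSubstitution A) (hprim : θ.IsPrimitive) (hne : θ.subshift.carrier.Nonempty)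
    (P : θ.Probabilities) (hP : P.NonDegenerate)
    (herg : Ergodic θ.shiftMap P.frequencyMeasure) :
    AddAction.IsMinimal ℤ θ.Space ↔
      ∀ (ℓ : ℕ) [NeZero ℓ] (Q Q' : θ.Probabilities), Q.NonDegenerate → Q'.NonDegenerate →
        Q.rightVector ℓ = Q'.rightVector ℓ := by
  constructor
  · intro hmin ℓ _ Q Q' hQ hQ'
    exact RandomSubstitution.Probabilities.rightVector_eq_of_isMinimal hprim hne hmin ℓ hQ hQ'
  · intro h
    exact RandomSubstitution.Probabilities.isMinimal_of_rightVector_eq hprim hne hP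
      fun ℓ _ Q hQ => h ℓ Q P hQ hP
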